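/- Let $n\ge 2$ and let $\Omega, D\subset\mathbb{R}^n$ be bounded Lipschitz domains (connected open sets whose boundary is locally flattened by bi-Lipschitz maps) with $\overline D\subset\Omega$. Let $k_0>0$, let $\sigma$ be the surface measure on $\partial\Omega$ and let $f\in L^2(\partial\Omega)$ be real-valued. Let $\mathfrak t:H^1(\Omega)\to L^2(\partial\Omega)$ be the trace operator and let $$V=\Big\{u\in H^1(\Omega):\ \int_{\partial\Omega}\mathfrak t u\,d\sigma=0\Big\},\qquad \|u\|_V=\|\nabla u\|_{L^2(\Omega)}.$$ For $k\in(0,\infty)\setminus\{k_0\}$ put $\mathbf a_D(k)=k_0+(k-k_0)\chi_D$, where $\chi_D$ is the characteristic function of $D$. Then there is a unique $u_D(k)\in V$ with $$\int_\Omega \mathbf a_D(k)\nabla u_D(k)\cdot\nabla v\,dx=\int_{\partial\Omega} f\,\mathfrak t v\,d\sigma\qquad\text{for all } v\in V,$$ and the mappings $$k\in(0,\infty)\setminus\{k_0\}\mapsto \mathfrak t u_D(k)\in L^2(\partial\Omega),\qquad k\in(0,\infty)\setminus\{k_0\}\mapsto u_D(k)\in V$$ are real analytic. Moreover, for every integer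 $j\ge 0$ and every $k\in(0,\infty)\setminus\{k_0\}$, the $j$-th derivative satisfies $$\|u_D^{(j)}(k)\|_V\le C\,j!\,\min(k,k_0)^{-(j+1)},\qquad C=\|\mathfrak t\|\,\|f\|_{L^2(\partial\Omega)},$$ where $\|\mathfrak t\|$ is the norm of $\mathfrak t$ as an operator from $(V,\|\cdot\|_V)$ to $L^2(\partial\Omega)$. -/

import Mathlib

open MeasureTheory Set Filter Topology
open scoped ContDiff

noncomputable section

namespace Inclusion

/-- Euclidean space `ℝⁿ`. -/
abbrev E (n : ℕ) : Type := EuclideanSpace ℝ (Fin n)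

/-! ### Lipschitz domains -/

/-- The reference cylinder `{(x', t) : |x'| < 1, |t| < 1}` of `ℝⁿ = ℝⁿ⁻¹ × ℝ`. -/
def refCylinder (n : ℕ) : Set (E (n - 1) × ℝ) := {p | ‖p.1‖ < 1 ∧ |p.2| < 1}

/-- The upper half `t > 0` of the reference cylinder. -/
def refUpper (n : ℕ) : Set (E (n - 1) × ℝ) := {p | p ∈ refCylinder n ∧ 0 < p.2}

/-- The middle section `t = 0` of the reference cylinder. -/
def refFlat (n : ℕ) : Set (E (n - 1) × ℝ) := {p | p ∈ refCylinder n ∧ p.2 = 0}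

/-- Bounded Lipschitz domains of `ℝⁿ`: bounded, connected, nonempty open sets `U` such that every
boundary point has an open neighbourhood `W` that is the image of the reference cylinder under a
bi-Lipschitz map which carries the upper half onto `U ∩ W` and the middle section onto
`∂U ∩ W`. -/
structure IsLipschitzDomain {n : ℕ} (U : Set (E n)) : Prop where
  isOpen : IsOpen U
  isConnected : IsConnected U
  isBounded : Bornology.IsBounded U
  exists_chart : ∀ x ∈ frontier U, ∃ (W : Set (E n)) (φ : E (n - 1) × ℝ → E n) (L : ℝ),
    IsOpen W ∧ x ∈ W ∧
    (∀ p ∈ refCylinder n, ∀ q ∈ refCylinder n,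
      dist (φ p) (φ q) ≤ L * dist p q ∧ dist p q ≤ L * dist (φ p) (φ q)) ∧
    φ '' refCylinder n = W ∧ φ '' refUpper n = U ∩ W ∧ φ '' refFlat n = frontier U ∩ W

/-! ### The Sobolev space `H¹(Ω)` -/

/-- `G` is the weak gradient of `u` on `Ω`. -/
def IsWeakGradient {n : ℕ} (Ω : Set (E n)) (u : E n → ℝ) (G : E n → E n) : Prop :=
  ∀ φ : E n → ℝ, ContDiff ℝ ∞ φ → HasCompactSupport φ → tsupport φ ⊆ Ω → ∀ e : E n,
    ∫ x in Ω, u x * fderiv ℝ φ x e = - ∫ x in Ω, inner ℝ (G x) e * φ x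

/-- The Hilbert space `L²(Ω) × L²(Ω; ℝⁿ)`. -/
abbrev L2Pair {n : ℕ} (Ω : Set (E n)) : Type :=
  WithLp 2 (Lp ℝ 2 (volume.restrict Ω) × Lp (E n) 2 (volume.restrict Ω))

theorem integrable_mul_deriv {n : ℕ} {Ω : Set (E n)} (u : Lp ℝ 2 (volume.restrict Ω))
    {φ : E n → ℝ} (hφ : ContDiff ℝ ∞ φ) (hc : HasCompactSupport φ) (e : E n) :
    Integrable (fun x => u x * fderiv ℝ φ x e) (volume.restrict Ω) := by
  have h1 : Continuous (fun x => fderiv ℝ φ x e) :=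
    (hφ.continuous_fderiv (by simp)).clm_apply continuous_const
  have h2 : HasCompactSupport (fun x => fderiv ℝ φ x e) := hc.fderiv_apply ℝ e
  exact (Lp.memLp u).integrable_mul (q := 2) (h1.memLp_of_hasCompactSupport h2)

theorem integrable_inner_mul {n : ℕ} {Ω : Set (E n)} (G : Lp (E n) 2 (volume.restrict Ω))
    {φ : E n → ℝ} (hφ : ContDiff ℝ ∞ φ) (hc : HasCompactSupport φ) (e : E n) :
    Integrable (fun x => inner ℝ (G x) e * φ x) (volume.restrict Ω) :=
  ((Lp.memLp G).inner_const e).integrable_mul (q := 2) (hφ.continuous.memLp_of_hasCompactSupport hc)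

/-- `H¹(Ω)`, realised as the space of pairs `(u, ∇u)` with `u ∈ L²(Ω)` whose weak gradient `∇u`
is in `L²(Ω; ℝⁿ)`; the norm is `(‖u‖² + ‖∇u‖²)^(1/2)`. -/
def H1 {n : ℕ} (Ω : Set (E n)) : Submodule ℝ (L2Pair Ω) where
  carrier := {p | IsWeakGradient Ω p.fst p.snd}
  zero_mem' := by
    intro φ _ _ _ e
    have h1 : (fun x => (0 : Lp ℝ 2 (volume.restrict Ω)) x * fderiv ℝ φ x e)
        =ᵐ[volume.restrict Ω] fun _ => 0 := by
      filter_upwards [Lp.coeFn_zero ℝ 2 (volume.restrict Ω)] with x hx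
      rw [hx]
      simp
    have h2 : (fun x => inner ℝ ((0 : Lp (E n) 2 (volume.restrict Ω)) x) e * φ x)
        =ᵐ[volume.restrict Ω] fun _ => 0 := by
      filter_upwards [Lp.coeFn_zero (E n) 2 (volume.restrict Ω)] with x hx
      rw [hx]
      simp
    change ∫ x in Ω, (0 : Lp ℝ 2 (volume.restrict Ω)) x * fderiv ℝ φ x e
      = - ∫ x in Ω, inner ℝ ((0 : Lp (E n) 2 (volume.restrict Ω)) x) e * φ x
    rw [integral_congr_ae h1, integral_congr_ae h2]
    simp
  add_mem' := by
    intro p q hp hq φ hφ hc hs e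
    have h1 : (fun x => (p.fst + q.fst) x * fderiv ℝ φ x e)
        =ᵐ[volume.restrict Ω] fun x => p.fst x * fderiv ℝ φ x e + q.fst x * fderiv ℝ φ x e := by
      filter_upwards [Lp.coeFn_add p.fst q.fst] with x hx
      rw [hx, Pi.add_apply, add_mul]
    have h2 : (fun x => inner ℝ ((p.snd + q.snd) x) e * φ x)
        =ᵐ[volume.restrict Ω] fun x => inner ℝ (p.snd x) e * φ x + inner ℝ (q.snd x) e * φ x := by
      filter_upwards [Lp.coeFn_add p.snd q.snd] with x hx
      rw [hx, Pi.add_apply, inner_add_left, add_mul]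
    change ∫ x in Ω, (p.fst + q.fst) x * fderiv ℝ φ x e
      = - ∫ x in Ω, inner ℝ ((p.snd + q.snd) x) e * φ x
    rw [integral_congr_ae h1, integral_congr_ae h2,
      integral_add (integrable_mul_deriv _ hφ hc e) (integrable_mul_deriv _ hφ hc e),
      integral_add (integrable_inner_mul _ hφ hc e) (integrable_inner_mul _ hφ hc e),
      hp φ hφ hc hs e, hq φ hφ hc hs e]
    ring
  smul_mem' := by
    intro c p hp φ hφ hc hs e
    have h1 : (fun x => (c • p.fst) x * fderiv ℝ φ x e)
        =ᵐ[volume.restrict Ω] fun x => c * (p.fst x * fderiv ℝ φ x e) := by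
      filter_upwards [Lp.coeFn_smul c p.fst] with x hx
      rw [hx, Pi.smul_apply, smul_eq_mul, mul_assoc]
    have h2 : (fun x => inner ℝ ((c • p.snd) x) e * φ x)
        =ᵐ[volume.restrict Ω] fun x => c * (inner ℝ (p.snd x) e * φ x) := by
      filter_upwards [Lp.coeFn_smul c p.snd] with x hx
      rw [hx, Pi.smul_apply, inner_smul_left, mul_assoc]; rfl
    change ∫ x in Ω, (c • p.fst) x * fderiv ℝ φ x e
      = - ∫ x in Ω, inner ℝ ((c • p.snd) x) e * φ x
    rw [integral_congr_ae h1, integral_congr_ae h2, integral_const_mul, integral_const_mul,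
      hp φ hφ hc hs e]
    ring

/-- The function underlying an element of `H¹(Ω)`. -/
def toFun {n : ℕ} {Ω : Set (E n)} (u : H1 Ω) : Lp ℝ 2 (volume.restrict Ω) :=
  (u : L2Pair Ω).fst

/-- The weak gradient of an element of `H¹(Ω)`. -/
def weakGrad {n : ℕ} {Ω : Set (E n)} (u : H1 Ω) : Lp (E n) 2 (volume.restrict Ω) :=
  (u : L2Pair Ω).snd

/-! ### Surface measure and trace -/

/-- The surface measure `dσ` of `∂Ω`: the `(n-1)`-dimensional Hausdorff measure on `∂Ω`,
normalised so that it agrees with Lebesgue measure on `(n-1)`-dimensional planes. -/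
def surfaceMeasure {n : ℕ} (Ω : Set (E n)) : Measure (E n) :=
  (Measure.euclideanHausdorffMeasure (n - 1)).restrict (frontier Ω)

/-- `L²(∂Ω)`. -/
abbrev BdryL2 {n : ℕ} (Ω : Set (E n)) : Type := Lp ℝ 2 (surfaceMeasure Ω)

/-- `g` is the trace of `u ∈ H¹(Ω)`: there are functions `φ m`, smooth up to the boundary, which
converge to `u` in `H¹(Ω)` and whose restrictions to `∂Ω` converge to `g` in `L²(∂Ω)`. -/
def IsTrace {n : ℕ} {Ω : Set (E n)} (u : H1 Ω) (g : BdryL2 Ω) : Prop :=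
  ∃ φ : ℕ → E n → ℝ, (∀ m, ContDiff ℝ ∞ (φ m)) ∧
    Tendsto (fun m => eLpNorm (fun x => φ m x - toFun u x) 2 (volume.restrict Ω)) atTop (𝓝 0) ∧
    Tendsto (fun m => eLpNorm (fun x => gradient (φ m) x - weakGrad u x) 2 (volume.restrict Ω))
      atTop (𝓝 0) ∧
    Tendsto (fun m => eLpNorm (fun x => φ m x - g x) 2 (surfaceMeasure Ω)) atTop (𝓝 0)

open Classical in
/-- The trace operator `𝔱`. The value `0` is used for an element of `H¹(Ω)` that has no trace,
which does not occur on a Lipschitz domain. -/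
def trace {n : ℕ} {Ω : Set (E n)} (u : H1 Ω) : BdryL2 Ω :=
  if h : ∃ g, IsTrace u g then h.choose else 0

/-- The space `V` of the functions of `H¹(Ω)` whose trace has integral zero over `∂Ω`. -/
def V {n : ℕ} (Ω : Set (E n)) : Set (H1 Ω) :=
  {u | (∃ g, IsTrace u g) ∧ ∫ x, trace u x ∂(surfaceMeasure Ω) = 0}

/-- The norm `‖u‖_V = ‖∇u‖_{L²(Ω)}`, induced by the scalar product `∫_Ω ∇u · ∇v` of `V`. -/
def normV {n : ℕ} {Ω : Set (E n)} (u : H1 Ω) : ℝ := ‖weakGrad u‖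

/-- The norm of the trace operator as an operator from `(V, ‖·‖_V)` to `L²(∂Ω)`. -/
def traceNorm {n : ℕ} (Ω : Set (E n)) : ℝ :=
  sInf {c : ℝ | 0 ≤ c ∧ ∀ v ∈ V Ω, ‖trace v‖ ≤ c * normV v}

/-! ### The boundary value problem -/

/-- The conductivity `𝐚_D(k) = k₀ + (k - k₀) χ_D`. -/
def conductivity {n : ℕ} (D : Set (E n)) (k₀ k : ℝ) (x : E n) : ℝ :=
  k₀ + (k - k₀) * D.indicator (fun _ => (1 : ℝ)) x

/-- `u ∈ V` is a variational solution of `div (𝐚_D(k) ∇u) = 0` in `Ω`, `k₀ ∂_ν u = f` on `∂Ω`: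
`∫_Ω 𝐚_D(k) ∇u · ∇v = ∫_{∂Ω} f v dσ` for all `v ∈ V`. -/
def IsVariationalSolution {n : ℕ} {Ω : Set (E n)} (D : Set (E n)) (k₀ : ℝ) (f : BdryL2 Ω)
    (k : ℝ) (u : H1 Ω) : Prop :=
  u ∈ V Ω ∧ ∀ v ∈ V Ω,
    ∫ x in Ω, conductivity D k₀ k x * inner ℝ (weakGrad u x) (weakGrad v x)
      = ∫ x, f x * trace v x ∂(surfaceMeasure Ω)

open Classical in
/-- The variational solution `u_D(k)` (and `0` where there is none). -/
def solution {n : ℕ} {Ω : Set (E n)} (D : Set (E n)) (k₀ : ℝ) (f : BdryL2 Ω) (k : ℝ) : H1 Ω :=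
  if h : ∃ u, IsVariationalSolution D k₀ f k u then h.choose else 0

end Inclusion

end

noncomputable section

namespace Inclusion

open scoped NNReal ENNReal

/-! ### Differentiable functions along Lipschitz curves -/

/-! With `A` and `P` the operators of the forms `∫_Ω ∇u · ∇v` and `∫_D ∇u · ∇v` on `V`, the weak
problem reads `S(k) w = F`, where `S(k) = k₀ A + (k - k₀) P` is affine in `k`. Since `0 ≤ P ≤ A` as
forms, `S(k)` dominates `min(k, k₀) A`. So it is invertible for all `k > 0`, and `w` is analytic
because inversion of operators is. Differentiating `S(k) w = F` repeatedly gives `S w⁽ʲ⁺¹⁾ = -(j +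
1) P w⁽ʲ⁾`. Testing with `w⁽ʲ⁺¹⁾` costs one factor `(j + 1) / min(k, k₀)` per derivative, in the
energy norm and with no further constant (`IsEnergyPair.norm_iteratedDeriv_resolvent_le`).

The analytic work is to make `V` a Hilbert space with a bounded trace. It is realised as a closed
subspace of triples (function, gradient, trace) in the closure of the smooth ones, where the trace
is a coordinate projection. Coercivity is `exists_norm_le_norm_grad_add`, which rests on a trace
inequality and on Poincaré's inequality for Lipschitz domains. Both are proved directly for smooth
functions in the charts and globalised by finite covers, without compact embeddings. The charts are
only bi-Lipschitz, so the chain rule is replaced by an estimate along Lipschitz curves and the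
change of variables by one-sided bounds for Hausdorff measures. -/

/-- The curve may fail to be differentiable, so there is no chain rule. Instead, the right upper
slopes of `φ ∘ γ` are at most `L ‖fderiv ℝ φ (γ s)‖`, which is the derivative of the right-hand
side, and a comparison principle concludes. -/
theorem comp_le_add_integral_of_lipschitzWith {X : Type*} [NormedAddCommGroup X] [NormedSpace ℝ X]
    {γ : ℝ → X} {L : ℝ≥0} (hγ : LipschitzWith L γ) {φ : X → ℝ} (hφ : ContDiff ℝ 1 φ) {t : ℝ}
    (ht : 0 ≤ t) :
    φ (γ t) ≤ φ (γ 0) + ∫ s in (0 : ℝ)..t, L * ‖fderiv ℝ φ (γ s)‖ := by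
  have hc : Continuous fun s => (L : ℝ) * ‖fderiv ℝ φ (γ s)‖ :=
    continuous_const.mul ((hφ.continuous_fderiv (by simp)).comp hγ.continuous).norm
  have hB : ∀ x, HasDerivAt (fun t => φ (γ 0) + ∫ s in (0 : ℝ)..t, L * ‖fderiv ℝ φ (γ s)‖)
      (L * ‖fderiv ℝ φ (γ x)‖) x := fun x =>
    (hc.integral_hasStrictDerivAt 0 x).hasDerivAt.const_add _
  refine image_le_of_liminf_slope_right_le_deriv_boundary (f := fun t => φ (γ t)) (a := 0) (b := t)
    (hφ.continuous.comp hγ.continuous).continuousOn (by simp)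
    (fun x _ => (hB x).continuousAt.continuousWithinAt) (fun x _ => (hB x).hasDerivWithinAt) ?_
    ⟨ht, le_rfl⟩
  intro x _ r hr
  obtain ⟨ε, hε, hεr⟩ : ∃ ε > 0, (L : ℝ) * (‖fderiv ℝ φ (γ x)‖ + ε) < r := by
    have h : Tendsto (fun ε : ℝ => (L : ℝ) * (‖fderiv ℝ φ (γ x)‖ + ε)) (𝓝[>] 0)
        (𝓝 (L * (‖fderiv ℝ φ (γ x)‖ + 0))) :=
      (Continuous.tendsto (by fun_prop) 0).mono_left nhdsWithin_le_nhds
    rw [add_zero] at h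
    obtain ⟨ε, h1, h2⟩ := ((h.eventually (gt_mem_nhds hr)).and self_mem_nhdsWithin).exists
    exact ⟨ε, h2, h1⟩
  have hd := ((hφ.differentiable (by simp)) (γ x)).hasFDerivAt.isLittleO.def hε
  have hd' := (hγ.continuous.tendsto x).eventually hd
  refine Eventually.frequently ?_
  filter_upwards [nhdsWithin_le_nhds hd', self_mem_nhdsWithin] with z hz hxz
  have hxz' : 0 < z - x := sub_pos.2 hxz
  rw [slope_def_field, div_lt_iff₀ hxz']
  have h1 : ‖γ z - γ x‖ ≤ L * (z - x) := by
    have := hγ.dist_le_mul z x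
    rwa [dist_eq_norm, Real.dist_eq, abs_of_pos hxz'] at this
  have h2 := (le_abs_self _).trans ((fderiv ℝ φ (γ x)).le_opNorm (γ z - γ x))
  have h3 := (le_abs_self _).trans hz
  have h4 : (‖fderiv ℝ φ (γ x)‖ + ε) * ‖γ z - γ x‖
      ≤ (‖fderiv ℝ φ (γ x)‖ + ε) * (L * (z - x)) := by gcongr
  nlinarith

theorem abs_comp_sub_le_integral_of_lipschitzWith {X : Type*} [NormedAddCommGroup X]
    [NormedSpace ℝ X] {γ : ℝ → X} {L : ℝ≥0} (hγ : LipschitzWith L γ) {φ : X → ℝ}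
    (hφ : ContDiff ℝ 1 φ) {t : ℝ} (ht : 0 ≤ t) :
    |φ (γ t) - φ (γ 0)| ≤ ∫ s in (0 : ℝ)..t, L * ‖fderiv ℝ φ (γ s)‖ := by
  have h1 := comp_le_add_integral_of_lipschitzWith hγ hφ ht
  have h2 := comp_le_add_integral_of_lipschitzWith hγ hφ.neg ht
  have h3 : ∀ x, fderiv ℝ (fun x => -φ x) x = - fderiv ℝ φ x := fun x => fderiv_neg
  simp only [h3, norm_neg] at h2
  rw [abs_le]
  constructor <;> linarith

theorem sq_lintegral_le {α : Type*} [MeasurableSpace α] (μ : Measure α) {f : α → ℝ≥0∞}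
    (hf : AEMeasurable f μ) : (∫⁻ x, f x ∂μ) ^ 2 ≤ μ univ * ∫⁻ x, f x ^ 2 ∂μ := by
  have h := ENNReal.lintegral_mul_le_Lp_mul_Lq μ Real.HolderConjugate.two_two
    (aemeasurable_const (b := (1 : ℝ≥0∞))) hf
  simp only [Pi.mul_apply, one_mul, ENNReal.one_rpow, lintegral_const] at h
  calc (∫⁻ x, f x ∂μ) ^ 2
      ≤ ((μ univ) ^ (1 / 2 : ℝ) * (∫⁻ x, f x ^ (2 : ℝ) ∂μ) ^ (1 / 2 : ℝ)) ^ 2 := by gcongr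
    _ = _ := by
      rw [mul_pow, ← ENNReal.rpow_natCast, ← ENNReal.rpow_natCast, ← ENNReal.rpow_mul,
        ← ENNReal.rpow_mul]
      norm_num

/-- A `C¹` function changes along a Lipschitz curve at most by the `L²` norm of its gradient. -/
theorem enorm_comp_sub_sq_le {X : Type*} [NormedAddCommGroup X] [NormedSpace ℝ X]
    {γ : ℝ → X} {L : ℝ≥0} {t : ℝ} (ht : 0 ≤ t) (ht1 : t ≤ 1) (hγ : LipschitzOnWith L γ (Icc 0 t))
    {φ : X → ℝ} (hφ : ContDiff ℝ 1 φ) :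
    ‖φ (γ t) - φ (γ 0)‖ₑ ^ 2 ≤ L ^ 2 * ∫⁻ s in Ioc 0 t, ‖fderiv ℝ φ (γ s)‖ₑ ^ 2 := by
  -- Projecting the parameter onto `[0, t]` extends the curve to a globally Lipschitz one.
  set γ' : ℝ → X := fun s => γ (projIcc 0 t ht s) with hγ'
  have hl : LipschitzWith L γ' := by
    have := (hγ.to_restrict).comp (LipschitzWith.projIcc ht)
    rw [mul_one] at this
    exact this
  have he : ∀ s ∈ Icc 0 t, γ' s = γ s := fun s hs => by simp [hγ', projIcc_of_mem ht hs]
  have h1 := abs_comp_sub_le_integral_of_lipschitzWith hl hφ ht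
  rw [he t ⟨ht, le_rfl⟩, he 0 ⟨le_rfl, ht⟩, intervalIntegral.integral_of_le ht] at h1
  have hc : Continuous fun s => (L : ℝ) * ‖fderiv ℝ φ (γ' s)‖ :=
    continuous_const.mul ((hφ.continuous_fderiv (by simp)).comp hl.continuous).norm
  have h2 : ‖φ (γ t) - φ (γ 0)‖ₑ ≤ ∫⁻ s in Ioc 0 t, L * ‖fderiv ℝ φ (γ s)‖ₑ := by
    rw [← ofReal_norm, Real.norm_eq_abs]
    refine (ENNReal.ofReal_le_ofReal h1).trans ?_
    rw [ofReal_integral_eq_lintegral_ofReal]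
    · refine le_of_eq (setLIntegral_congr_fun measurableSet_Ioc fun s hs => ?_)
      simp only [he s ⟨hs.1.le, hs.2⟩]
      rw [ENNReal.ofReal_mul L.coe_nonneg, ofReal_norm]
      simp
    · exact (hc.continuousOn.integrableOn_compact isCompact_Icc).mono_set Ioc_subset_Icc_self
    · exact ae_of_all _ fun s => by positivity
  have hm : AEMeasurable (fun s => ‖fderiv ℝ φ (γ s)‖ₑ) (volume.restrict (Ioc 0 t)) := by
    have : Continuous fun s => fderiv ℝ φ (γ' s) :=
      (hφ.continuous_fderiv (by simp)).comp hl.continuous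
    refine this.enorm.measurable.aemeasurable.congr ?_
    filter_upwards [ae_restrict_mem measurableSet_Ioc] with s hs
    rw [he s ⟨hs.1.le, hs.2⟩]
  rw [lintegral_const_mul'' _ hm] at h2
  calc ‖φ (γ t) - φ (γ 0)‖ₑ ^ 2
      ≤ (L * ∫⁻ s in Ioc 0 t, ‖fderiv ℝ φ (γ s)‖ₑ) ^ 2 := by gcongr
    _ = L ^ 2 * (∫⁻ s in Ioc 0 t, ‖fderiv ℝ φ (γ s)‖ₑ) ^ 2 := by rw [mul_pow]
    _ ≤ L ^ 2 * (volume.restrict (Ioc 0 t) univ * ∫⁻ s in Ioc 0 t, ‖fderiv ℝ φ (γ s)‖ₑ ^ 2) := by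
      gcongr
      exact sq_lintegral_le _ hm
    _ ≤ L ^ 2 * (1 * ∫⁻ s in Ioc 0 t, ‖fderiv ℝ φ (γ s)‖ₑ ^ 2) := by
      gcongr
      simpa using ht1
    _ = _ := by rw [one_mul]

/-! ### Poincaré's inequality on convex sets -/

theorem enorm_sub_sq_le {a b c : ℝ} : ‖a - c‖ₑ ^ 2 ≤ 2 * (‖a - b‖ₑ ^ 2 + ‖b - c‖ₑ ^ 2) := by
  have h : |a - c| ^ 2 ≤ 2 * (|a - b| ^ 2 + |b - c| ^ 2) := by
    simp only [sq_abs]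
    nlinarith [sq_nonneg (a - b - (b - c))]
  have h' := ENNReal.ofReal_le_ofReal h
  rw [ENNReal.ofReal_mul (by norm_num), ENNReal.ofReal_add (by positivity) (by positivity),
    ENNReal.ofReal_pow (abs_nonneg _), ENNReal.ofReal_pow (abs_nonneg _),
    ENNReal.ofReal_pow (abs_nonneg _)] at h'
  simpa [← Real.enorm_eq_ofReal_abs] using h'

section Convex

variable {F : Type*} [NormedAddCommGroup F] [NormedSpace ℝ F] [FiniteDimensional ℝ F]
  [MeasurableSpace F] [BorelSpace F] (μ : Measure F) [μ.IsAddHaarMeasure]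

theorem lintegral_add_smul {G : F → ℝ≥0∞} (hG : Measurable G) (a : F) {s : ℝ} (hs : 0 < s) :
    ∫⁻ q, G (a + s • q) ∂μ = ENNReal.ofReal ((s ^ Module.finrank ℝ F)⁻¹) * ∫⁻ q, G q ∂μ := by
  have h1 : ∫⁻ q, G (a + s • q) ∂μ = ∫⁻ q, G (a + q) ∂(Measure.map (s • ·) μ) :=
    (lintegral_map (hG.comp (measurable_const_add a)) (measurable_const_smul s)).symm
  rw [h1, Measure.map_addHaar_smul μ hs.ne', lintegral_smul_measure, lintegral_add_left_eq_self,
    abs_of_pos (by positivity), smul_eq_mul]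

/-- One of the weights `s` and `1 - s` is at least `1/2`. Integrating first in the variable that
carries it, the substitution costs at most `2 ^ finrank`, uniformly in `s`. -/
theorem setLIntegral_lineMap_le {G : F → ℝ≥0∞} (hG : Measurable G) (K : Set F) (s : ℝ) :
    ∫⁻ p in K, ∫⁻ q in K, G (AffineMap.lineMap p q s) ∂μ ∂μ
      ≤ 2 ^ Module.finrank ℝ F * (μ K * ∫⁻ q, G q ∂μ) := by
  have hl : ∀ p q : F, AffineMap.lineMap p q s = (1 - s) • p + s • q := fun p q => by
    rw [AffineMap.lineMap_apply_module]
  have key : ∀ (a : F) (r : ℝ), 1 / 2 ≤ r →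
      ∫⁻ q in K, G (a + r • q) ∂μ ≤ 2 ^ Module.finrank ℝ F * ∫⁻ q, G q ∂μ := by
    intro a r hr
    refine (setLIntegral_le_lintegral _ _).trans ?_
    rw [lintegral_add_smul μ hG a (by linarith)]
    gcongr
    calc ENNReal.ofReal ((r ^ Module.finrank ℝ F)⁻¹)
        ≤ ENNReal.ofReal (2 ^ Module.finrank ℝ F) := by
          apply ENNReal.ofReal_le_ofReal
          rw [← inv_pow]
          gcongr
          rw [inv_le_comm₀ (by linarith) (by norm_num)]
          linarith
      _ = 2 ^ Module.finrank ℝ F := by rw [ENNReal.ofReal_pow (by norm_num)]; simp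
  have hconst : ∀ f : F → ℝ≥0∞, (∀ p, f p ≤ 2 ^ Module.finrank ℝ F * ∫⁻ q, G q ∂μ) →
      ∫⁻ p in K, f p ∂μ ≤ 2 ^ Module.finrank ℝ F * (μ K * ∫⁻ q, G q ∂μ) := by
    intro f hf
    refine (lintegral_mono hf).trans ?_
    rw [lintegral_const, Measure.restrict_apply_univ]
    apply le_of_eq
    ring
  rcases le_total (1 / 2) s with h | h
  · refine hconst _ fun p => ?_
    simp only [hl]
    exact key _ s h
  · have hmeas : Measurable fun z : F × F => G (AffineMap.lineMap z.1 z.2 s) := by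
      simp only [hl]
      exact hG.comp (by fun_prop)
    rw [lintegral_lintegral_swap hmeas.aemeasurable]
    refine hconst _ fun q => ?_
    simp only [hl, add_comm _ (s • q)]
    exact key _ (1 - s) (by linarith)

/-- Poincaré's inequality for the pullback of a `C¹` function by a map that is Lipschitz on a
bounded convex open set. -/
theorem exists_lintegral_sub_sq_le {X : Type*} [NormedAddCommGroup X] [NormedSpace ℝ X]
    {K : Set F} (hKo : IsOpen K) (hKc : Convex ℝ K) (hKn : K.Nonempty) {d : ℝ≥0}
    (hd : ∀ p ∈ K, ∀ q ∈ K, dist p q ≤ d) {Φ : F → X} {L : ℝ≥0} (hΦ : LipschitzOnWith L Φ K)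
    {φ : X → ℝ} (hφ : ContDiff ℝ 1 φ) :
    ∃ c : ℝ, ∫⁻ p in K, ‖φ (Φ p) - c‖ₑ ^ 2 ∂μ
      ≤ (L * d) ^ 2 * 2 ^ Module.finrank ℝ F * ∫⁻ p in K, ‖fderiv ℝ φ (Φ p)‖ₑ ^ 2 ∂μ := by
  classical
  set N := Module.finrank ℝ F
  -- Extension by zero: integrals over rescaled copies of `K` may be enlarged to the whole space at
  -- no cost.
  set G : F → ℝ≥0∞ := K.piecewise (fun p => ‖fderiv ℝ φ (Φ p)‖ₑ ^ 2) 0 with hG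
  have hφ' : Continuous (fderiv ℝ φ) := hφ.continuous_fderiv (by simp)
  have hGm : Measurable G := by
    refine ContinuousOn.measurable_piecewise ?_ continuousOn_const hKo.measurableSet
    exact (ENNReal.continuous_pow 2).comp_continuousOn
      ((hφ'.comp_continuousOn hΦ.continuousOn).enorm)
  have hGK : ∀ p ∈ K, G p = ‖fderiv ℝ φ (Φ p)‖ₑ ^ 2 := fun p hp => by simp [hG, hp]
  have hGi : ∫⁻ p, G p ∂μ = ∫⁻ p in K, ‖fderiv ℝ φ (Φ p)‖ₑ ^ 2 ∂μ := by
    rw [← lintegral_indicator hKo.measurableSet]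
    rfl
  have hseg : ∀ p ∈ K, ∀ q ∈ K, ‖φ (Φ q) - φ (Φ p)‖ₑ ^ 2
      ≤ (L * d) ^ 2 * ∫⁻ s in Ioc (0 : ℝ) 1, G (AffineMap.lineMap p q s) := by
    intro p hp q hq
    have hmem : ∀ s ∈ Icc (0 : ℝ) 1, AffineMap.lineMap p q s ∈ K := fun s hs =>
      hKc.lineMap_mem hp hq hs
    have hlip : LipschitzOnWith (L * d) (fun s : ℝ => Φ (AffineMap.lineMap p q s))
        (Icc 0 1) := by
      refine LipschitzOnWith.comp (t := K) hΦ ?_ hmem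
      refine LipschitzOnWith.of_dist_le_mul fun s _ t _ => ?_
      rw [dist_lineMap_lineMap, mul_comm]
      gcongr
      exact hd p hp q hq
    have h := enorm_comp_sub_sq_le zero_le_one le_rfl hlip hφ
    simp only [AffineMap.lineMap_apply_one, AffineMap.lineMap_apply_zero] at h
    push_cast at h
    refine h.trans (le_of_eq ?_)
    congr 1
    refine setLIntegral_congr_fun measurableSet_Ioc fun s hs => ?_
    rw [hGK _ (hmem s ⟨hs.1.le, hs.2⟩)]
  have hKb : Bornology.IsBounded K := Metric.isBounded_iff.2 ⟨d, fun p hp q hq => hd p hp q hq⟩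
  have hK0 : μ K ≠ 0 := (hKo.measure_pos μ hKn).ne'
  have hKt : μ K ≠ ⊤ := hKb.measure_lt_top.ne
  have hlm : Measurable fun z : (F × F) × ℝ => G (AffineMap.lineMap z.1.1 z.1.2 z.2) := by
    simp only [AffineMap.lineMap_apply_module]
    exact hGm.comp (by fun_prop)
  have hdouble : ∫⁻ q in K, ∫⁻ p in K, ‖φ (Φ p) - φ (Φ q)‖ₑ ^ 2 ∂μ ∂μ
      ≤ (L * d) ^ 2 * (2 ^ N * (μ K * ∫⁻ p, G p ∂μ)) := by
    calc ∫⁻ q in K, ∫⁻ p in K, ‖φ (Φ p) - φ (Φ q)‖ₑ ^ 2 ∂μ ∂μ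
        ≤ ∫⁻ q in K, ∫⁻ p in K, (L * d) ^ 2 *
            (∫⁻ s in Ioc (0 : ℝ) 1, G (AffineMap.lineMap q p s)) ∂μ ∂μ := by
          refine setLIntegral_mono' hKo.measurableSet fun q hq => ?_
          exact setLIntegral_mono' hKo.measurableSet fun p hp => hseg q hq p hp
      _ = (L * d) ^ 2 * ∫⁻ s in Ioc (0 : ℝ) 1, ∫⁻ q in K, ∫⁻ p in K,
            G (AffineMap.lineMap q p s) ∂μ ∂μ := by
          have hne : ((L : ℝ≥0∞) * d) ^ 2 ≠ ⊤ := by finiteness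
          simp only [lintegral_const_mul' _ _ hne]
          congr 1
          refine (lintegral_congr fun q => lintegral_lintegral_swap ?_).trans
            (lintegral_lintegral_swap ?_)
          · exact (hlm.comp (f := fun z : F × ℝ => ((q, z.1), z.2)) (by fun_prop)).aemeasurable
          · refine Measurable.aemeasurable ?_
            exact Measurable.lintegral_prod_right'
              (f := fun z : (F × ℝ) × F => G (AffineMap.lineMap z.1.1 z.2 z.1.2))
              (hlm.comp (f := fun z : (F × ℝ) × F => ((z.1.1, z.2), z.1.2)) (by fun_prop))
      _ ≤ (L * d) ^ 2 * ∫⁻ s in Ioc (0 : ℝ) 1, 2 ^ N * (μ K * ∫⁻ p, G p ∂μ) := by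
          refine mul_le_mul' le_rfl ?_
          exact lintegral_mono fun s => setLIntegral_lineMap_le μ hGm K s
      _ = _ := by simp
  have hcont : ContinuousOn (fun p => φ (Φ p)) K := hφ.continuous.comp_continuousOn hΦ.continuousOn
  have hw : Measurable (K.piecewise (fun p => φ (Φ p)) 0) :=
    hcont.measurable_piecewise continuousOn_const hKo.measurableSet
  -- `Φ` is controlled on `K` only, so measurability is checked for a version cut off outside `K`.
  have hae : AEMeasurable (fun q => ∫⁻ p in K, ‖φ (Φ p) - φ (Φ q)‖ₑ ^ 2 ∂μ) (μ.restrict K) := by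
    have h1 : Measurable fun q => ∫⁻ p in K,
        ‖K.piecewise (fun p => φ (Φ p)) 0 p - K.piecewise (fun p => φ (Φ p)) 0 q‖ₑ ^ 2 ∂μ := by
      refine Measurable.lintegral_prod_right' (f := fun z : F × F =>
        ‖K.piecewise (fun p => φ (Φ p)) 0 z.2 - K.piecewise (fun p => φ (Φ p)) 0 z.1‖ₑ ^ 2) ?_
      exact ((hw.comp measurable_snd).sub (hw.comp measurable_fst)).enorm.pow_const 2
    refine h1.aemeasurable.congr ?_
    filter_upwards [ae_restrict_mem hKo.measurableSet] with q hq
    refine setLIntegral_congr_fun hKo.measurableSet fun p hp => ?_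
    simp [hp, hq]
  -- The constant is the value at a well-chosen point `q`, where the inner integral does not exceed
  -- its average over `K`; this replaces the mean value. The division by `μ K` cancels the factor in
  -- `hdouble`.
  obtain ⟨q, _, hq⟩ := exists_le_setLAverage hK0 hKt hae
  refine ⟨φ (Φ q), hq.trans ?_⟩
  rw [setLAverage_eq]
  refine ENNReal.div_le_of_le_mul (hdouble.trans (le_of_eq ?_))
  rw [hGi]
  ring

end Convex

/-! ### Hausdorff measures and Lipschitz maps -/

section Hausdorff

variable {X Y : Type*} [MetricSpace X] [MeasurableSpace X] [BorelSpace X]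
  [MetricSpace Y] [MeasurableSpace Y] [BorelSpace Y]

theorem euclideanHausdorffMeasure_image_le {ψ : X → Y} {K : Set X} {L : ℝ≥0}
    (hψ : LipschitzOnWith L ψ K) (d : ℕ) : μHE[d] (ψ '' K) ≤ L ^ d * μHE[d] K := by
  simp only [Measure.euclideanHausdorffMeasure_def, Measure.smul_apply]
  have h := hψ.hausdorffMeasure_image_le (d := d) (by positivity)
  rw [ENNReal.rpow_natCast] at h
  rw [mul_smul_comm]
  gcongr

/-- The comparison of measures of images is upgraded to an inequality between the restricted measure
and a pushforward. Neither injectivity of `ψ` nor measurability of `g` is needed. -/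
theorem setLIntegral_image_le {ψ : X → Y} {K : Set X} (hK : MeasurableSet K) {L : ℝ≥0}
    (hψ : LipschitzOnWith L ψ K) (d : ℕ) (g : Y → ℝ≥0∞) :
    ∫⁻ y in ψ '' K, g y ∂μHE[d] ≤ L ^ d * ∫⁻ x in K, g (ψ x) ∂μHE[d] := by
  have hm : AEMeasurable ψ (Measure.restrict μHE[d] K) := hψ.continuousOn.aemeasurable hK
  have hle : Measure.restrict μHE[d] (ψ '' K)
      ≤ ((L : ℝ≥0∞) ^ d) • Measure.map ψ (Measure.restrict μHE[d] K) := by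
    refine Measure.le_iff.2 fun B hB => ?_
    rw [Measure.restrict_apply hB, Measure.smul_apply, smul_eq_mul]
    calc μHE[d] (B ∩ ψ '' K) = μHE[d] (ψ '' (ψ ⁻¹' B ∩ K)) := by rw [image_preimage_inter]
      _ ≤ L ^ d * μHE[d] (ψ ⁻¹' B ∩ K) :=
        euclideanHausdorffMeasure_image_le (hψ.mono inter_subset_right) d
      _ ≤ _ := by
        gcongr
        exact (Measure.le_restrict_apply _ _).trans (Measure.le_map_apply hm B)
  calc ∫⁻ y in ψ '' K, g y ∂μHE[d]
      ≤ ∫⁻ y, g y ∂(((L : ℝ≥0∞) ^ d) • Measure.map ψ (Measure.restrict μHE[d] K)) :=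
        lintegral_mono' hle le_rfl
    _ = L ^ d * ∫⁻ y, g y ∂(Measure.map ψ (Measure.restrict μHE[d] K)) := by
        rw [lintegral_smul_measure, smul_eq_mul]
    _ ≤ _ := by
        gcongr
        exact lintegral_map_le _ _

/-- The lower bi-Lipschitz bound makes `ψ` injective on `K` with Lipschitz inverse, to which
`setLIntegral_image_le` applies. -/
theorem setLIntegral_comp_le {ψ : X → Y} {K : Set X} (hK : MeasurableSet (ψ '' K)) {L : ℝ≥0}
    (hψ : ∀ p ∈ K, ∀ q ∈ K, dist p q ≤ L * dist (ψ p) (ψ q)) (d : ℕ) (g : Y → ℝ≥0∞) :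
    ∫⁻ x in K, g (ψ x) ∂μHE[d] ≤ L ^ d * ∫⁻ y in ψ '' K, g y ∂μHE[d] := by
  rcases K.eq_empty_or_nonempty with rfl | ⟨x₀, hx₀⟩
  · simp
  have : Nonempty X := ⟨x₀⟩
  have hinj : InjOn ψ K := fun p hp q hq h => by
    have := hψ p hp q hq
    rw [h, dist_self, mul_zero] at this
    exact dist_le_zero.1 this
  have hinv : LeftInvOn (Function.invFunOn ψ K) ψ K := hinj.leftInvOn_invFunOn
  have hlip : LipschitzOnWith L (Function.invFunOn ψ K) (ψ '' K) := by
    refine LipschitzOnWith.of_dist_le_mul ?_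
    rintro _ ⟨p, hp, rfl⟩ _ ⟨q, hq, rfl⟩
    rw [hinv hp, hinv hq]
    exact hψ p hp q hq
  have h := setLIntegral_image_le hK hlip d fun x => g (ψ x)
  rw [hinv.image_image] at h
  refine h.trans (le_of_eq ?_)
  congr 1
  refine setLIntegral_congr_fun hK ?_
  rintro _ ⟨p, hp, rfl⟩
  simp only [hinv hp]

end Hausdorff

/-! ### Local estimates in the charts of a Lipschitz domain -/

theorem refUpper_eq (n : ℕ) :
    refUpper n = Metric.ball (0 : E (n - 1)) 1 ×ˢ Ioo (0 : ℝ) 1 := by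
  ext p
  simp only [refUpper, refCylinder, mem_ofPred_eq, mem_prod, mem_ball_zero_iff, mem_Ioo]
  constructor
  · rintro ⟨⟨h1, h2⟩, h3⟩
    exact ⟨h1, h3, (abs_lt.1 h2).2⟩
  · rintro ⟨h1, h2, h3⟩
    exact ⟨⟨h1, abs_lt.2 ⟨by linarith, h3⟩⟩, h2⟩

theorem refFlat_eq (n : ℕ) :
    refFlat n = (fun x : E (n - 1) => (x, (0 : ℝ))) '' Metric.ball 0 1 := by
  ext ⟨x, t⟩
  simp only [refFlat, refCylinder, mem_ofPred_eq, mem_image, mem_ball_zero_iff, Prod.mk.injEq]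
  constructor
  · rintro ⟨⟨h1, -⟩, rfl⟩
    exact ⟨x, h1, rfl, rfl⟩
  · rintro ⟨y, h1, rfl, rfl⟩
    exact ⟨⟨h1, by simp⟩, rfl⟩

/-- The product carries the sup metric, so its Hausdorff measure need not be the product Lebesgue
measure. Being a Haar measure suffices for the convex Poincaré inequality. -/
theorem isAddHaarMeasure_cylinder {n : ℕ} (hn : 1 ≤ n) :
    (μHE[n] : Measure (E (n - 1) × ℝ)).IsAddHaarMeasure := by
  have h : Module.finrank ℝ (E (n - 1) × ℝ) = n := by simp; omega
  have := isAddHaarMeasure_euclideanHausdorffMeasure (E := E (n - 1) × ℝ)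
  rwa [h] at this

/-- `A` satisfies Poincaré's inequality with respect to the gradient on `U`. -/
def PoincareOn {n : ℕ} (U A : Set (E n)) : Prop :=
  ∃ C : ℝ≥0∞, C ≠ ⊤ ∧ ∀ φ : E n → ℝ, ContDiff ℝ 1 φ → ∃ c : ℝ,
    ∫⁻ x in A, ‖φ x - c‖ₑ ^ 2 ≤ C * ∫⁻ x in U, ‖fderiv ℝ φ x‖ₑ ^ 2

/-- The `L²` norm on `A` is controlled by the `H¹` norm on `U`. -/
def TraceBoundOn {n : ℕ} (U A : Set (E n)) : Prop :=
  ∃ C : ℝ≥0∞, C ≠ ⊤ ∧ ∀ φ : E n → ℝ, ContDiff ℝ 1 φ →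
    ∫⁻ x in A, ‖φ x‖ₑ ^ 2 ∂μHE[n - 1]
      ≤ C * ∫⁻ x in U, (‖φ x‖ₑ ^ 2 + ‖fderiv ℝ φ x‖ₑ ^ 2)

theorem IsLipschitzDomain.exists_chart_nnreal {n : ℕ} {U : Set (E n)} (hU : IsLipschitzDomain U)
    {x : E n} (hx : x ∈ frontier U) :
    ∃ (W : Set (E n)) (Φ : E (n - 1) × ℝ → E n) (L : ℝ≥0), IsOpen W ∧ x ∈ W ∧
      LipschitzOnWith L Φ (refCylinder n) ∧
      (∀ p ∈ refCylinder n, ∀ q ∈ refCylinder n, dist p q ≤ L * dist (Φ p) (Φ q)) ∧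
      Φ '' refUpper n = U ∩ W ∧
      (fun y : E (n - 1) => Φ (y, 0)) '' Metric.ball 0 1 = frontier U ∩ W := by
  obtain ⟨W, Φ, L, hW, hxW, hL, -, h1, h2⟩ := hU.exists_chart x hx
  refine ⟨W, Φ, L.toNNReal, hW, hxW, LipschitzOnWith.of_dist_le_mul fun p hp q hq => ?_,
    fun p hp q hq => ?_, h1, ?_⟩
  · exact (hL p hp q hq).1.trans (by gcongr; exact Real.le_coe_toNNReal L)
  · exact (hL p hp q hq).2.trans (by gcongr; exact Real.le_coe_toNNReal L)
  · rw [← h2, refFlat_eq, image_image]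

/-- The upper half-cylinder is convex and bounded, so Poincaré's inequality holds there for the
pullback. The upper Lipschitz bound of the chart transports its left side to `U ∩ W`, the lower one
its right side. -/
theorem IsLipschitzDomain.exists_poincareOn_of_mem_frontier {n : ℕ} (hn : 1 ≤ n) {U : Set (E n)}
    (hU : IsLipschitzDomain U) {x : E n} (hx : x ∈ frontier U) :
    ∃ W : Set (E n), IsOpen W ∧ x ∈ W ∧ PoincareOn U (U ∩ W) := by
  obtain ⟨W, Φ, L, hW, hxW, hL, hL', h1, -⟩ := hU.exists_chart_nnreal hx
  have := isAddHaarMeasure_cylinder hn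
  have hsub : refUpper n ⊆ refCylinder n := fun p hp => hp.1
  have ho : IsOpen (refUpper n) := by
    rw [refUpper_eq]
    exact Metric.isOpen_ball.prod isOpen_Ioo
  have hc : Convex ℝ (refUpper n) := by
    rw [refUpper_eq]
    exact (convex_ball _ _).prod (convex_Ioo _ _)
  have hne : (refUpper n).Nonempty := by
    rw [refUpper_eq]
    exact (Metric.nonempty_ball.2 one_pos).prod (nonempty_Ioo.2 one_pos)
  have hd : ∀ p ∈ refUpper n, ∀ q ∈ refUpper n, dist p q ≤ (2 : ℝ≥0) := by
    rintro p ⟨⟨hp1, hp2⟩, -⟩ q ⟨⟨hq1, hq2⟩, -⟩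
    rw [Prod.dist_eq, max_le_iff]
    constructor
    · refine (dist_le_norm_add_norm _ _).trans ?_
      push_cast
      linarith
    · rw [Real.dist_eq]
      refine (abs_sub _ _).trans ?_
      push_cast
      linarith
  have hvol : (volume : Measure (E n)) = μHE[n] :=
    (EuclideanSpace.euclideanHausdorffMeasure_eq_volume n).symm
  refine ⟨W, hW, hxW, L ^ n * ((L * (2 : ℝ≥0)) ^ 2 * 2 ^ Module.finrank ℝ (E (n - 1) × ℝ) * L ^ n),
    by finiteness, fun φ hφ => ?_⟩
  obtain ⟨c, hc⟩ := exists_lintegral_sub_sq_le μHE[n] ho hc hne hd (hL.mono hsub) hφ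
  refine ⟨c, ?_⟩
  calc ∫⁻ x in U ∩ W, ‖φ x - c‖ₑ ^ 2
      ≤ L ^ n * ∫⁻ p in refUpper n, ‖φ (Φ p) - c‖ₑ ^ 2 ∂μHE[n] := by
        rw [← h1, hvol]
        exact setLIntegral_image_le ho.measurableSet (hL.mono hsub) n fun x => ‖φ x - c‖ₑ ^ 2
    _ ≤ L ^ n * ((L * (2 : ℝ≥0)) ^ 2 * 2 ^ Module.finrank ℝ (E (n - 1) × ℝ) *
          ∫⁻ p in refUpper n, ‖fderiv ℝ φ (Φ p)‖ₑ ^ 2 ∂μHE[n]) := by gcongr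
    _ ≤ L ^ n * ((L * (2 : ℝ≥0)) ^ 2 * 2 ^ Module.finrank ℝ (E (n - 1) × ℝ) *
          (L ^ n * ∫⁻ x in U ∩ W, ‖fderiv ℝ φ x‖ₑ ^ 2)) := by
        gcongr
        rw [← h1, hvol]
        refine setLIntegral_comp_le ?_ (fun p hp q hq => hL' p (hsub hp) q (hsub hq)) n
          fun x => ‖fderiv ℝ φ x‖ₑ ^ 2
        rw [h1]
        exact (hU.isOpen.inter hW).measurableSet
    _ ≤ L ^ n * ((L * (2 : ℝ≥0)) ^ 2 * 2 ^ Module.finrank ℝ (E (n - 1) × ℝ) *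
          (L ^ n * ∫⁻ x in U, ‖fderiv ℝ φ x‖ₑ ^ 2)) := by
        gcongr
        exact inter_subset_left
    _ = _ := by ring

/-- On each vertical segment of the chart, the boundary value is bounded by the value at height `t`
plus the gradient along the segment. Averaging over `t`, then integrating over the base, gives the
bound. -/
theorem IsLipschitzDomain.exists_traceBoundOn {n : ℕ} (hn : 1 ≤ n) {U : Set (E n)}
    (hU : IsLipschitzDomain U) {x : E n} (hx : x ∈ frontier U) :
    ∃ W : Set (E n), IsOpen W ∧ x ∈ W ∧ TraceBoundOn U (frontier U ∩ W) := by
  obtain ⟨W, Φ, L, hW, hxW, hL, hL', h1, h2⟩ := hU.exists_chart_nnreal hx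
  have := isAddHaarMeasure_cylinder hn
  have hsub : refUpper n ⊆ refCylinder n := fun p hp => hp.1
  have ho : IsOpen (refUpper n) := by
    rw [refUpper_eq]
    exact Metric.isOpen_ball.prod isOpen_Ioo
  have hvol : (volume : Measure (E n)) = μHE[n] :=
    (EuclideanSpace.euclideanHausdorffMeasure_eq_volume n).symm
  have hvol' : (volume : Measure (E (n - 1))) = μHE[n - 1] :=
    (EuclideanSpace.euclideanHausdorffMeasure_eq_volume (n - 1)).symm
  have hcyl : ∀ y ∈ Metric.ball (0 : E (n - 1)) 1, ∀ t ∈ Ico (0 : ℝ) 1,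
      (y, t) ∈ refCylinder n := fun y hy t ht =>
    ⟨by simpa using hy, abs_lt.2 ⟨by linarith [ht.1], ht.2⟩⟩
  have hflat : LipschitzOnWith L (fun y : E (n - 1) => Φ (y, 0)) (Metric.ball 0 1) := by
    refine LipschitzOnWith.of_dist_le_mul fun y hy z hz => ?_
    refine (hL.dist_le_mul _ (hcyl y hy 0 (by simp)) _ (hcyl z hz 0 (by simp))).trans ?_
    simp [Prod.dist_eq]
  -- Fubini needs the product measure, the chart estimate the Hausdorff measure; both are Haar,
  -- hence proportional.
  obtain ⟨κ, hκ⟩ : ∃ κ : ℝ≥0, (volume : Measure (E (n - 1) × ℝ)) = κ • μHE[n] := by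
    have : (volume : Measure (E (n - 1) × ℝ)).IsAddHaarMeasure := by
      rw [Measure.volume_eq_prod]
      infer_instance
    exact ⟨_, Measure.isAddLeftInvariant_eq_smul _ _⟩
  refine ⟨W, hW, hxW, L ^ (n - 1) * (κ * (L ^ n * (2 * (1 + L ^ 2)))), by finiteness,
    fun φ hφ => ?_⟩
  have hφ' : Continuous (fderiv ℝ φ) := hφ.continuous_fderiv (by simp)
  set h : E n → ℝ≥0∞ := fun x => 2 * (‖φ x‖ₑ ^ 2 + L ^ 2 * ‖fderiv ℝ φ x‖ₑ ^ 2) with hh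
  have hhc : Continuous h := by
    refine ENNReal.continuous_const_mul (by simp) |>.comp ?_
    refine ((ENNReal.continuous_pow 2).comp hφ.continuous.enorm).add ?_
    exact (ENNReal.continuous_const_mul (by finiteness)).comp
      ((ENNReal.continuous_pow 2).comp hφ'.enorm)
  have hline : ∀ y ∈ Metric.ball (0 : E (n - 1)) 1,
      ‖φ (Φ (y, 0))‖ₑ ^ 2 ≤ ∫⁻ t in Ioo (0 : ℝ) 1, h (Φ (y, t)) := by
    intro y hy
    set J := ∫⁻ t in Ioo (0 : ℝ) 1, ‖fderiv ℝ φ (Φ (y, t))‖ₑ ^ 2 with hJ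
    have hpt : ∀ t ∈ Ioo (0 : ℝ) 1,
        ‖φ (Φ (y, 0))‖ₑ ^ 2 ≤ 2 * (‖φ (Φ (y, t))‖ₑ ^ 2 + L ^ 2 * J) := by
      intro t ht
      have hγ : LipschitzOnWith L (fun s : ℝ => Φ (y, s)) (Icc 0 t) := by
        refine LipschitzOnWith.of_dist_le_mul fun s hs r hr => ?_
        refine (hL.dist_le_mul _ (hcyl y hy s ⟨hs.1, hs.2.trans_lt ht.2⟩) _
          (hcyl y hy r ⟨hr.1, hr.2.trans_lt ht.2⟩)).trans ?_
        simp [Prod.dist_eq]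
      have h3 := enorm_comp_sub_sq_le ht.1.le ht.2.le hγ hφ
      have h4 := enorm_sub_sq_le (a := φ (Φ (y, 0))) (b := φ (Φ (y, t))) (c := 0)
      rw [sub_zero, sub_zero, enorm_sub_rev, add_comm] at h4
      refine h4.trans ?_
      gcongr
      refine h3.trans ?_
      gcongr
      exact lintegral_mono_set fun s hs => ⟨hs.1, hs.2.trans_lt ht.2⟩
    calc ‖φ (Φ (y, 0))‖ₑ ^ 2 = ∫⁻ _ in Ioo (0 : ℝ) 1, ‖φ (Φ (y, 0))‖ₑ ^ 2 := by simp
      _ ≤ ∫⁻ t in Ioo (0 : ℝ) 1, 2 * (‖φ (Φ (y, t))‖ₑ ^ 2 + L ^ 2 * J) :=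
        setLIntegral_mono' measurableSet_Ioo hpt
      _ = 2 * ((∫⁻ t in Ioo (0 : ℝ) 1, ‖φ (Φ (y, t))‖ₑ ^ 2) + L ^ 2 * J) := by
        rw [lintegral_const_mul' _ _ (by simp), lintegral_add_right _ measurable_const]
        simp
      _ = 2 * ((∫⁻ t in Ioo (0 : ℝ) 1, ‖φ (Φ (y, t))‖ₑ ^ 2)
            + ∫⁻ t in Ioo (0 : ℝ) 1, L ^ 2 * ‖fderiv ℝ φ (Φ (y, t))‖ₑ ^ 2) := by
        rw [lintegral_const_mul' _ _ (by finiteness)]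
      _ ≤ 2 * ∫⁻ t in Ioo (0 : ℝ) 1,
            (‖φ (Φ (y, t))‖ₑ ^ 2 + L ^ 2 * ‖fderiv ℝ φ (Φ (y, t))‖ₑ ^ 2) := by
        gcongr
        exact le_lintegral_add _ _
      _ = _ := by rw [lintegral_const_mul' _ _ (by simp)]
  have hmeas : AEMeasurable (fun p : E (n - 1) × ℝ => h (Φ p))
      (((volume : Measure (E (n - 1))).restrict (Metric.ball 0 1)).prod
        ((volume : Measure ℝ).restrict (Ioo 0 1))) := by
    rw [Measure.prod_restrict, ← refUpper_eq]
    exact (hhc.comp_continuousOn (hL.mono hsub).continuousOn).aemeasurable ho.measurableSet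
  calc ∫⁻ x in frontier U ∩ W, ‖φ x‖ₑ ^ 2 ∂μHE[n - 1]
      ≤ L ^ (n - 1) * ∫⁻ y in Metric.ball (0 : E (n - 1)) 1, ‖φ (Φ (y, 0))‖ₑ ^ 2 := by
        rw [← h2, hvol']
        exact setLIntegral_image_le measurableSet_ball hflat (n - 1) fun x => ‖φ x‖ₑ ^ 2
    _ ≤ L ^ (n - 1) * ∫⁻ y in Metric.ball (0 : E (n - 1)) 1,
          ∫⁻ t in Ioo (0 : ℝ) 1, h (Φ (y, t)) := by
        exact mul_le_mul' le_rfl (setLIntegral_mono' measurableSet_ball hline)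
    _ = L ^ (n - 1) * ∫⁻ p in refUpper n, h (Φ p) := by
        rw [← lintegral_prod _ hmeas, Measure.prod_restrict, ← refUpper_eq, Measure.volume_eq_prod]
    _ = L ^ (n - 1) * (κ * ∫⁻ p in refUpper n, h (Φ p) ∂μHE[n]) := by
        rw [hκ, Measure.restrict_smul, lintegral_smul_measure]
        rfl
    _ ≤ L ^ (n - 1) * (κ * (L ^ n * ∫⁻ x in U ∩ W, h x)) := by
        gcongr
        rw [← h1, hvol]
        refine setLIntegral_comp_le ?_ (fun p hp q hq => hL' p (hsub hp) q (hsub hq)) n h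
        rw [h1]
        exact (hU.isOpen.inter hW).measurableSet
    _ ≤ L ^ (n - 1) * (κ * (L ^ n *
          ∫⁻ x in U, 2 * (1 + L ^ 2) * (‖φ x‖ₑ ^ 2 + ‖fderiv ℝ φ x‖ₑ ^ 2))) := by
        refine mul_le_mul' le_rfl (mul_le_mul' le_rfl (mul_le_mul' le_rfl ?_))
        refine (lintegral_mono_set inter_subset_left).trans (lintegral_mono fun x => ?_)
        rw [mul_assoc]
        simp only [hh]
        gcongr
        calc ‖φ x‖ₑ ^ 2 + (L : ℝ≥0∞) ^ 2 * ‖fderiv ℝ φ x‖ₑ ^ 2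
            ≤ (‖φ x‖ₑ ^ 2 + (L : ℝ≥0∞) ^ 2 * ‖fderiv ℝ φ x‖ₑ ^ 2)
              + ((L : ℝ≥0∞) ^ 2 * ‖φ x‖ₑ ^ 2 + ‖fderiv ℝ φ x‖ₑ ^ 2) := le_self_add
          _ = _ := by ring
    _ = _ := by
        rw [lintegral_const_mul' _ _ (by finiteness)]
        ring

/-- The inverse chart is Lipschitz and maps a boundary patch onto a ball of positive measure.
Positivity ensures that the boundary integral detects constants. -/
theorem IsLipschitzDomain.measure_frontier_pos {n : ℕ} {U : Set (E n)}
    (hU : IsLipschitzDomain U) (hf : (frontier U).Nonempty) :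
    (μHE[n - 1] : Measure (E n)) (frontier U) ≠ 0 := by
  obtain ⟨x, hx⟩ := hf
  obtain ⟨W, Φ, L, hW, hxW, hL, hL', h1, h2⟩ := hU.exists_chart_nnreal hx
  have hcyl : ∀ y ∈ Metric.ball (0 : E (n - 1)) 1, (y, (0 : ℝ)) ∈ refCylinder n := fun y hy =>
    ⟨by simpa using hy, by simp⟩
  have h := setLIntegral_comp_le (ψ := fun y : E (n - 1) => Φ (y, 0)) (K := Metric.ball 0 1)
    (L := L) (by rw [h2]; exact isClosed_frontier.measurableSet.inter hW.measurableSet)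
    (fun y hy z hz => by
      refine le_trans ?_ (hL' _ (hcyl y hy) _ (hcyl z hz))
      simp [Prod.dist_eq]) (n - 1) 1
  simp only [Pi.one_apply, lintegral_one, Measure.restrict_apply_univ, h2,
    EuclideanSpace.euclideanHausdorffMeasure_eq_volume] at h
  intro h0
  rw [measure_mono_null inter_subset_left h0, mul_zero] at h
  exact (Metric.isOpen_ball.measure_pos volume (Metric.nonempty_ball.2 one_pos)).ne'
    (le_antisymm h zero_le)

/-! ### Global estimates -/

/-- The property passes to subsets and finite unions, so compactness of the boundary reduces it to
the charts. -/
theorem IsLipschitzDomain.traceBoundOn_frontier {n : ℕ} (hn : 1 ≤ n) {U : Set (E n)}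
    (hU : IsLipschitzDomain U) : TraceBoundOn U (frontier U) := by
  have hc : IsCompact (frontier U) := Metric.isCompact_of_isClosed_isBounded isClosed_frontier
    (hU.isBounded.closure.subset frontier_subset_closure)
  refine hc.induction_on (p := TraceBoundOn U) ⟨0, by simp, by simp⟩ ?_ ?_ ?_
  · rintro s t hst ⟨C, hC, h⟩
    exact ⟨C, hC, fun φ hφ => (lintegral_mono_set hst).trans (h φ hφ)⟩
  · rintro s t ⟨C, hC, h⟩ ⟨C', hC', h'⟩
    refine ⟨C + C', by finiteness, fun φ hφ => (lintegral_union_le _ _ _).trans ?_⟩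
    rw [add_mul]
    exact add_le_add (h φ hφ) (h' φ hφ)
  · intro x hx
    obtain ⟨W, hW, hxW, h⟩ := hU.exists_traceBoundOn hn hx
    exact ⟨_, inter_mem self_mem_nhdsWithin (mem_nhdsWithin_of_mem_nhds (hW.mem_nhds hxW)), h⟩

/-- This is the trace bound tested with the constant function `1`. -/
theorem IsLipschitzDomain.measure_frontier_lt_top {n : ℕ} (hn : 1 ≤ n) {U : Set (E n)}
    (hU : IsLipschitzDomain U) : (μHE[n - 1] : Measure (E n)) (frontier U) < ⊤ := by
  obtain ⟨C, hC, h⟩ := hU.traceBoundOn_frontier hn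
  have h1 := h (fun _ => 1) contDiff_const
  simp only [enorm_one, one_pow, lintegral_const, one_mul, Measure.restrict_apply_univ,
    fderiv_const_apply] at h1
  have hv : volume U ≠ ⊤ := hU.isBounded.measure_lt_top.ne
  refine h1.trans_lt ?_
  finiteness

theorem IsLipschitzDomain.frontier_nonempty {n : ℕ} (hn : 1 ≤ n) {U : Set (E n)}
    (hU : IsLipschitzDomain U) : (frontier U).Nonempty := by
  have : Nonempty (Fin n) := ⟨⟨0, hn⟩⟩
  rw [nonempty_iff_ne_empty, Ne, ← isClopen_iff_frontier_eq_empty, isClopen_iff, not_or]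
  refine ⟨hU.isConnected.nonempty.ne_empty, fun h => ?_⟩
  exact NormedSpace.unbounded_univ ℝ (E n) (h ▸ hU.isBounded)

/-- The two approximating constants are compared on the overlap, which has positive measure;
afterwards the constant of `A` serves on `B` too. -/
theorem PoincareOn.union {n : ℕ} {U A B : Set (E n)} (hA : PoincareOn U A) (hB : PoincareOn U B)
    (hBt : volume B ≠ ⊤) (hAB : volume (A ∩ B) ≠ 0) : PoincareOn U (A ∪ B) := by
  obtain ⟨C₁, hC₁, h₁⟩ := hA
  obtain ⟨C₂, hC₂, h₂⟩ := hB
  have hABt : volume (A ∩ B) ≠ ⊤ := ne_top_of_le_ne_top hBt (measure_mono inter_subset_right)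
  refine ⟨C₁ + 2 * (C₂ + volume B * (2 * (C₁ + C₂) / volume (A ∩ B))),
    by finiteness, fun φ hφ => ?_⟩
  obtain ⟨c₁, hc₁⟩ := h₁ φ hφ
  obtain ⟨c₂, hc₂⟩ := h₂ φ hφ
  set I := ∫⁻ x in U, ‖fderiv ℝ φ x‖ₑ ^ 2
  have hm : ∀ c : ℝ, Measurable fun x => ‖φ x - c‖ₑ ^ 2 := fun c =>
    ((hφ.continuous.sub continuous_const).enorm.measurable).pow_const 2
  have hconst : ‖c₂ - c₁‖ₑ ^ 2 ≤ 2 * (C₁ + C₂) / volume (A ∩ B) * I := by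
    have h : ‖c₂ - c₁‖ₑ ^ 2 * volume (A ∩ B) ≤ 2 * (C₁ + C₂) * I := by
      calc ‖c₂ - c₁‖ₑ ^ 2 * volume (A ∩ B) = ∫⁻ _ in A ∩ B, ‖c₂ - c₁‖ₑ ^ 2 := by simp
        _ ≤ ∫⁻ x in A ∩ B, 2 * (‖φ x - c₁‖ₑ ^ 2 + ‖φ x - c₂‖ₑ ^ 2) := by
          refine lintegral_mono fun x => ?_
          have := enorm_sub_sq_le (a := c₂) (b := φ x) (c := c₁)
          rwa [enorm_sub_rev c₂ (φ x), add_comm] at this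
        _ = 2 * ((∫⁻ x in A ∩ B, ‖φ x - c₁‖ₑ ^ 2) + ∫⁻ x in A ∩ B, ‖φ x - c₂‖ₑ ^ 2) := by
          rw [lintegral_const_mul' _ _ (by simp), lintegral_add_left (hm c₁)]
        _ ≤ 2 * (C₁ * I + C₂ * I) := by
          gcongr
          · exact (lintegral_mono_set inter_subset_left).trans hc₁
          · exact (lintegral_mono_set inter_subset_right).trans hc₂
        _ = _ := by ring
    calc ‖c₂ - c₁‖ₑ ^ 2 ≤ 2 * (C₁ + C₂) * I / volume (A ∩ B) :=
          (ENNReal.le_div_iff_mul_le (Or.inl hAB) (Or.inl hABt)).2 h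
      _ = _ := by simp only [div_eq_mul_inv]; ring
  refine ⟨c₁, ?_⟩
  calc ∫⁻ x in A ∪ B, ‖φ x - c₁‖ₑ ^ 2
      ≤ (∫⁻ x in A, ‖φ x - c₁‖ₑ ^ 2) + ∫⁻ x in B, ‖φ x - c₁‖ₑ ^ 2 := lintegral_union_le _ _ _
    _ ≤ C₁ * I + ∫⁻ x in B, 2 * (‖φ x - c₂‖ₑ ^ 2 + ‖c₂ - c₁‖ₑ ^ 2) := by
      refine add_le_add hc₁ (lintegral_mono fun x => enorm_sub_sq_le)
    _ = C₁ * I + 2 * ((∫⁻ x in B, ‖φ x - c₂‖ₑ ^ 2) + ‖c₂ - c₁‖ₑ ^ 2 * volume B) := by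
      rw [lintegral_const_mul' _ _ (by simp), lintegral_add_left (hm c₂)]
      simp
    _ ≤ C₁ * I + 2 * (C₂ * I + 2 * (C₁ + C₂) / volume (A ∩ B) * I * volume B) := by gcongr
    _ = _ := by ring

/-- A maximal subfamily whose union satisfies the inequality absorbs every member that meets it,
since overlaps of open sets have positive measure. By connectedness nothing is left over. -/
theorem poincareOn_of_finite_cover {n : ℕ} {U : Set (E n)} (hUc : IsPreconnected U)
    (hUn : U.Nonempty) (hUt : volume U ≠ ⊤) {ι : Type*} (t : Finset ι) (O : ι → Set (E n))
    (hO : ∀ i ∈ t, IsOpen (O i)) (hOU : ∀ i ∈ t, O i ⊆ U) (hP : ∀ i ∈ t, PoincareOn U (O i))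
    (hcov : U ⊆ ⋃ i ∈ t, O i) : PoincareOn U U := by
  classical
  set Q : Set (Finset ι) := {S | S ⊆ t ∧ (⋃ i ∈ S, O i).Nonempty ∧ PoincareOn U (⋃ i ∈ S, O i)}
  have hQf : Q.Finite := (t.powerset.finite_toSet).subset fun S hS => by simpa using hS.1
  obtain ⟨x, hx⟩ := hUn
  obtain ⟨i₀, hi₀, hxi⟩ := mem_iUnion₂.1 (hcov hx)
  have hQn : Q.Nonempty := ⟨{i₀}, by simpa using hi₀, by simpa using ⟨x, hxi⟩,
    by simpa using hP i₀ hi₀⟩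
  obtain ⟨S, ⟨hSt, hSn, hSP⟩, hmax⟩ := hQf.exists_maximal hQn
  set A := ⋃ i ∈ S, O i with hA
  have hAU : A ⊆ U := iUnion₂_subset fun i hi => hOU i (hSt hi)
  have hAo : IsOpen A := isOpen_biUnion fun i hi => hO i (hSt hi)
  have hmeet : ∀ i ∈ t, (A ∩ O i).Nonempty → O i ⊆ A := by
    intro i hi hne
    have hins : insert i S ∈ Q := by
      refine ⟨Finset.insert_subset hi hSt, ?_, ?_⟩
      · rw [Finset.set_biUnion_insert]
        exact hSn.mono subset_union_right
      · rw [Finset.set_biUnion_insert, union_comm]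
        refine hSP.union (hP i hi) (ne_top_of_le_ne_top hUt (measure_mono (hOU i hi))) ?_
        exact ((hAo.inter (hO i hi)).measure_pos volume hne).ne'
    have hiS : i ∈ S := hmax hins (Finset.subset_insert _ _) (Finset.mem_insert_self _ _)
    exact subset_biUnion_of_mem (u := O) hiS
  have hUA : U ⊆ A := by
    refine hUc.subset_left_of_subset_union (v := ⋃ i ∈ {i ∈ t | Disjoint A (O i)}, O i) hAo
      (isOpen_biUnion fun i hi => hO i (Finset.mem_filter.1 hi).1) ?_ ?_ ?_
    · exact disjoint_iUnion₂_right.2 fun i hi => (Finset.mem_filter.1 hi).2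
    · intro y hy
      obtain ⟨i, hi, hyi⟩ := mem_iUnion₂.1 (hcov hy)
      by_cases hd : Disjoint A (O i)
      · exact Or.inr (mem_iUnion₂.2 ⟨i, Finset.mem_filter.2 ⟨hi, hd⟩, hyi⟩)
      · exact Or.inl (hmeet i hi (not_disjoint_iff_nonempty_inter.1 hd) hyi)
    · rwa [inter_eq_right.2 hAU]
  rwa [subset_antisymm hAU hUA] at hSP

theorem poincareOn_ball {n : ℕ} {U : Set (E n)} {x : E n} {r : ℝ} (hr : 0 < r)
    (hU : Metric.ball x r ⊆ U) : PoincareOn U (Metric.ball x r) := by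
  refine ⟨(((1 : ℝ≥0) : ℝ≥0∞) * (2 * r).toNNReal) ^ 2 * 2 ^ Module.finrank ℝ (E n), by finiteness,
    fun φ hφ => ?_⟩
  obtain ⟨c, hc⟩ := exists_lintegral_sub_sq_le (volume : Measure (E n)) Metric.isOpen_ball
    (convex_ball x r) (Metric.nonempty_ball.2 hr) (d := (2 * r).toNNReal)
    (fun p hp q hq => by
      rw [Real.coe_toNNReal _ (by positivity)]
      have h1 := Metric.mem_ball.1 hp
      have h2 := Metric.mem_ball'.1 hq
      linarith [dist_triangle p x q]) (LipschitzWith.id.lipschitzOnWith) hφ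
  exact ⟨c, hc.trans (mul_le_mul' le_rfl (lintegral_mono_set hU))⟩

theorem IsLipschitzDomain.poincareOn_self {n : ℕ} (hn : 1 ≤ n) {U : Set (E n)}
    (hU : IsLipschitzDomain U) : PoincareOn U U := by
  have hloc : ∀ x ∈ closure U, ∃ W : Set (E n), IsOpen W ∧ x ∈ W ∧ PoincareOn U (U ∩ W) := by
    intro x hx
    by_cases hxU : x ∈ U
    · obtain ⟨r, hr, hrU⟩ := Metric.isOpen_iff.1 hU.isOpen x hxU
      refine ⟨Metric.ball x r, Metric.isOpen_ball, Metric.mem_ball_self hr, ?_⟩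
      rw [inter_eq_right.2 hrU]
      exact poincareOn_ball hr hrU
    · refine hU.exists_poincareOn_of_mem_frontier hn ?_
      rw [hU.isOpen.frontier_eq]
      exact ⟨hx, hxU⟩
  choose! W hWo hxW hWP using hloc
  have hc : IsCompact (closure U) := Metric.isCompact_of_isClosed_isBounded isClosed_closure
    hU.isBounded.closure
  obtain ⟨t, ht, hcov⟩ := hc.elim_nhds_subcover W fun x hx => (hWo x hx).mem_nhds (hxW x hx)
  refine poincareOn_of_finite_cover hU.isConnected.isPreconnected hU.isConnected.nonempty
    hU.isBounded.measure_lt_top.ne t (fun x => U ∩ W x)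
    (fun x hx => hU.isOpen.inter (hWo x (ht x hx)))
    (fun x _ => inter_subset_left) (fun x hx => hWP x (ht x hx)) fun y hy => ?_
  obtain ⟨x, hx, hyx⟩ := mem_iUnion₂.1 (hcov (subset_closure hy))
  exact mem_iUnion₂.2 ⟨x, hx, hy, hyx⟩

/-! ### Affine families of coercive operators -/

section Abstract

variable {H : Type*} [NormedAddCommGroup H] [InnerProductSpace ℝ H]

/-- The operator of the form `⟪T x, T y⟫`. -/
def gramOp [CompleteSpace H] {Y : Type*} [NormedAddCommGroup Y] [InnerProductSpace ℝ Y]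
    [CompleteSpace Y] (T : H →L[ℝ] Y) : H →L[ℝ] H := (ContinuousLinearMap.adjoint T).comp T

theorem inner_gramOp [CompleteSpace H] {Y : Type*} [NormedAddCommGroup Y]
    [InnerProductSpace ℝ Y] [CompleteSpace Y] (T : H →L[ℝ] Y) (x y : H) :
    inner ℝ (gramOp T x) y = inner ℝ (T x) (T y) := by
  rw [gramOp, ContinuousLinearMap.comp_apply, ContinuousLinearMap.adjoint_inner_left]

/-- The form of `A` is the square of `N`, which bounds the norm of `H`, and the form of `P` is
nonnegative and dominated by that of `A`. -/
structure IsEnergyPair (A P : H →L[ℝ] H) (N : H → ℝ) (c : ℝ) : Prop where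
  nonneg : ∀ x, 0 ≤ N x
  norm_le : ∀ x, ‖x‖ ≤ c * N x
  inner_eq : ∀ x, inner ℝ (A x) x = N x ^ 2
  inner_nonneg : ∀ x, 0 ≤ inner ℝ (P x) x
  abs_inner_le : ∀ x y, |inner ℝ (P x) y| ≤ N x * N y

/-- The affine family `k₀ A + (k - k₀) P`. -/
def stiffness (A P : H →L[ℝ] H) (k₀ k : ℝ) : H →L[ℝ] H := k₀ • A + (k - k₀) • P

/-- The solution of `stiffness A P k₀ k x = F`. -/
def resolvent (A P : H →L[ℝ] H) (k₀ : ℝ) (F : H) (k : ℝ) : H :=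
  Ring.inverse (stiffness A P k₀ k) F

variable {A P : H →L[ℝ] H} {N : H → ℝ} {c k₀ : ℝ}

theorem inner_stiffness (A P : H →L[ℝ] H) (k₀ k : ℝ) (x y : H) :
    inner ℝ (stiffness A P k₀ k x) y
      = k₀ * inner ℝ (A x) y + (k - k₀) * inner ℝ (P x) y := by
  simp only [stiffness, add_apply, smul_apply, inner_add_left, real_inner_smul_left]

/-- The form equals `k₀ (N x ^ 2 - p) + k p` with `p = ⟪P x, x⟫` between `0` and `N x ^ 2`. -/
theorem IsEnergyPair.min_mul_sq_le_inner_stiffness (h : IsEnergyPair A P N c) (k₀ k : ℝ) (x : H) :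
    min k k₀ * N x ^ 2 ≤ inner ℝ (stiffness A P k₀ k x) x := by
  rw [inner_stiffness, h.inner_eq]
  have h1 : inner ℝ (P x) x ≤ N x ^ 2 := by
    rw [sq]
    exact (le_abs_self _).trans (h.abs_inner_le x x)
  have h2 := h.inner_nonneg x
  rcases le_total k k₀ with h | h
  · rw [min_eq_left h]
    nlinarith
  · rw [min_eq_right h]
    nlinarith

theorem hasDerivAt_stiffness (A P : H →L[ℝ] H) (k₀ k : ℝ) :
    HasDerivAt (fun k => stiffness A P k₀ k) P k := by
  have h := (((hasDerivAt_id k).sub_const k₀).smul_const P).const_add (k₀ • A)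
  rwa [one_smul] at h

variable [CompleteSpace H]

theorem IsEnergyPair.isUnit_stiffness (h : IsEnergyPair A P N c) (hk₀ : 0 < k₀)
    {k : ℝ} (hk : 0 < k) : IsUnit (stiffness A P k₀ k) := by
  have hm : 0 < min k k₀ := lt_min hk hk₀
  -- The constant `c` need not be positive, but a positive one is needed to divide by.
  set b : ℝ := max c 1
  have hb : 0 < b := lt_max_of_lt_right one_pos
  refine ContinuousLinearMap.isUnit_of_forall_le_norm_inner_map _
    (c := (min k k₀ / b ^ 2).toNNReal) (Real.toNNReal_pos.2 (by positivity)) fun x => ?_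
  rw [Real.coe_toNNReal _ (by positivity)]
  have hN := h.nonneg x
  have h1 : ‖x‖ ≤ b * N x := (h.norm_le x).trans (by gcongr; exact le_max_left _ _)
  have h2 : ‖x‖ ^ 2 ≤ b ^ 2 * N x ^ 2 := by
    rw [← mul_pow]
    gcongr
  refine le_trans ?_ (le_abs_self _)
  refine le_trans ?_ (h.min_mul_sq_le_inner_stiffness k₀ k x)
  calc ‖x‖ ^ 2 * (min k k₀ / b ^ 2) ≤ b ^ 2 * N x ^ 2 * (min k k₀ / b ^ 2) := by gcongr
    _ = _ := by field_simp

theorem IsEnergyPair.stiffness_apply_eq_iff (h : IsEnergyPair A P N c) (hk₀ : 0 < k₀) (F : H)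
    {k : ℝ} (hk : 0 < k) (x : H) : stiffness A P k₀ k x = F ↔ x = resolvent A P k₀ F k := by
  have hu := h.isUnit_stiffness hk₀ hk
  constructor
  · rintro rfl
    exact (congrArg (fun T : H →L[ℝ] H => T x) (Ring.inverse_mul_cancel _ hu)).symm
  · rintro rfl
    exact congrArg (fun T : H →L[ℝ] H => T F) (Ring.mul_inverse_cancel _ hu)

theorem IsEnergyPair.analyticAt_resolvent (h : IsEnergyPair A P N c) (hk₀ : 0 < k₀)
    (F : H) {k : ℝ} (hk : 0 < k) : AnalyticAt ℝ (resolvent A P k₀ F) k := by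
  obtain ⟨u, hu⟩ := h.isUnit_stiffness hk₀ hk
  have h1 : AnalyticAt ℝ (fun k => stiffness A P k₀ k) k :=
    analyticAt_const.add ((analyticAt_id.sub analyticAt_const).smul analyticAt_const)
  have h2 : AnalyticAt ℝ Ring.inverse (stiffness A P k₀ k) := hu ▸ analyticAt_inverse u
  exact ((ContinuousLinearMap.apply ℝ H F).analyticAt _).comp (h2.comp h1)

theorem IsEnergyPair.analyticAt_iteratedDeriv_resolvent (h : IsEnergyPair A P N c)
    (hk₀ : 0 < k₀) (F : H) (j : ℕ) {k : ℝ} (hk : 0 < k) :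
    AnalyticAt ℝ (iteratedDeriv j (resolvent A P k₀ F)) k := by
  rw [iteratedDeriv_eq_iterate]
  exact (h.analyticAt_resolvent hk₀ F hk).iterated_deriv j

theorem IsEnergyPair.hasDerivAt_iteratedDeriv_resolvent (h : IsEnergyPair A P N c)
    (hk₀ : 0 < k₀) (F : H) (j : ℕ) {k : ℝ} (hk : 0 < k) :
    HasDerivAt (iteratedDeriv j (resolvent A P k₀ F))
      (iteratedDeriv (j + 1) (resolvent A P k₀ F) k) k := by
  rw [iteratedDeriv_succ]
  exact (h.analyticAt_iteratedDeriv_resolvent hk₀ F j hk).differentiableAt.hasDerivAt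

/-- Leibniz' rule for `stiffness A P k₀ k (resolvent A P k₀ F k) = F`. -/
theorem IsEnergyPair.stiffness_iteratedDeriv_resolvent (h : IsEnergyPair A P N c)
    (hk₀ : 0 < k₀) (F : H) (j : ℕ) {k : ℝ} (hk : 0 < k) :
    stiffness A P k₀ k (iteratedDeriv (j + 1) (resolvent A P k₀ F) k)
      + ((j : ℝ) + 1) • P (iteratedDeriv j (resolvent A P k₀ F) k) = 0 := by
  have hd := fun (i : ℕ) (k : ℝ) (hk : 0 < k) =>
    h.hasDerivAt_iteratedDeriv_resolvent hk₀ F i hk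
  -- The identity is differentiated in `k`, so it must be known on a neighbourhood. Each
  -- differentiation of the stiffness contributes one more `P w⁽ʲ⁺¹⁾`, raising the coefficient `j +
  -- 1` to `j + 2`.
  induction j generalizing k with
  | zero =>
    have h1 := (hasDerivAt_stiffness A P k₀ k).clm_apply (hd 0 k hk)
    have h2 : (fun k => stiffness A P k₀ k (iteratedDeriv 0 (resolvent A P k₀ F) k))
        =ᶠ[𝓝 k] fun _ => F := by
      filter_upwards [lt_mem_nhds hk] with κ hκ
      rw [iteratedDeriv_zero, (h.stiffness_apply_eq_iff hk₀ F hκ _).2 rfl]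
    have h3 := (h1.congr_of_eventuallyEq h2.symm).unique (hasDerivAt_const k F)
    rw [add_comm, Nat.cast_zero, zero_add, one_smul]
    exact h3
  | succ j ih =>
    have h1 := ((hasDerivAt_stiffness A P k₀ k).clm_apply
      (hd (j + 1) k hk)).add
        ((P.hasFDerivAt.comp_hasDerivAt k (hd j k hk)).const_smul ((j : ℝ) + 1))
    have h3 := (h1.congr_of_eventuallyEq (f₁ := fun _ => (0 : H)) (by
      filter_upwards [lt_mem_nhds hk] with κ hκ
      exact (ih hκ).symm)).unique (hasDerivAt_const k (0 : H))
    rw [← h3]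
    push_cast
    module

/-- Each equation is tested with its own solution and one factor `N` cancelled. The norm of `H` and
the constant `c` never enter, which keeps the bound sharp. -/
theorem IsEnergyPair.norm_iteratedDeriv_resolvent_le (h : IsEnergyPair A P N c)
    (hk₀ : 0 < k₀) {F : H} {M : ℝ} (hM : 0 ≤ M)
    (hF : ∀ x, inner ℝ F x ≤ M * N x) (j : ℕ) {k : ℝ} (hk : 0 < k) :
    N (iteratedDeriv j (resolvent A P k₀ F) k) ≤ M * (j.factorial : ℝ) / min k k₀ ^ (j + 1) := by
  have hm : 0 < min k k₀ := lt_min hk hk₀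
  have key : ∀ (x : H) (b : ℝ), 0 ≤ b → inner ℝ (stiffness A P k₀ k x) x ≤ b * N x →
      N x ≤ b / min k k₀ := by
    intro x b hb hx
    rcases (h.nonneg x).eq_or_lt with h0 | h0
    · rw [← h0]
      positivity
    · rw [le_div_iff₀ hm]
      have := (h.min_mul_sq_le_inner_stiffness k₀ k x).trans hx
      refine le_of_mul_le_mul_right ?_ h0
      linarith
  induction j with
  | zero =>
    set w := iteratedDeriv 0 (resolvent A P k₀ F) k with hw
    have hF0 : stiffness A P k₀ k w = F := by
      rw [hw, iteratedDeriv_zero, (h.stiffness_apply_eq_iff hk₀ F hk _).2 rfl]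
    simpa using key w M hM (by rw [hF0]; exact hF w)
  | succ j ih =>
    set w := iteratedDeriv j (resolvent A P k₀ F) k
    set w' := iteratedDeriv (j + 1) (resolvent A P k₀ F) k
    have h1 : inner ℝ (stiffness A P k₀ k w') w' ≤ (((j : ℝ) + 1) * N w) * N w' := by
      have := h.stiffness_iteratedDeriv_resolvent hk₀ F j hk
      rw [add_eq_zero_iff_eq_neg] at this
      rw [this, inner_neg_left, real_inner_smul_left, mul_assoc, ← mul_neg]
      gcongr
      exact (neg_le_abs _).trans (h.abs_inner_le _ _)
    have hw := h.nonneg w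
    refine (key w' _ (by positivity) h1).trans ?_
    rw [Nat.factorial_succ, pow_succ (min k k₀) (j + 1), ← div_div]
    gcongr
    push_cast
    calc ((j : ℝ) + 1) * N w ≤ (j + 1) * (M * (j.factorial : ℝ) / min k k₀ ^ (j + 1)) := by
          gcongr
      _ = _ := by ring

end Abstract

/-! ### Functions smooth up to the boundary and their traces -/

section Spaces

variable {n : ℕ} {Ω : Set (E n)}

/-- The Hilbert space `L²(Ω) × L²(Ω; ℝⁿ) × L²(∂Ω)`. -/
abbrev TraceTriple (Ω : Set (E n)) : Type := WithLp 2 (L2Pair Ω × BdryL2 Ω)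

/-- The gradient component. -/
def gradCLM (Ω : Set (E n)) : TraceTriple Ω →L[ℝ] Lp (E n) 2 (volume.restrict Ω) :=
  (WithLp.sndL 2 ℝ _ _).comp (WithLp.fstL 2 ℝ _ _)

/-- The boundary component. -/
def bdryCLM (Ω : Set (E n)) : TraceTriple Ω →L[ℝ] BdryL2 Ω := WithLp.sndL 2 ℝ _ _

theorem gradient_smul_add {φ ψ : E n → ℝ} (hφ : ContDiff ℝ ∞ φ) (hψ : ContDiff ℝ ∞ ψ) (c : ℝ)
    (x : E n) : gradient (fun x => c * φ x + ψ x) x = c • gradient φ x + gradient ψ x := by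
  have h1 : DifferentiableAt ℝ φ x := hφ.differentiable (by simp) x
  have h2 : DifferentiableAt ℝ ψ x := hψ.differentiable (by simp) x
  simp only [gradient]
  rw [fderiv_fun_add (h1.const_mul c) h2, fderiv_const_mul h1]
  simp

theorem enorm_gradient (φ : E n → ℝ) (x : E n) : ‖gradient φ x‖ₑ = ‖fderiv ℝ φ x‖ₑ := by
  rw [gradient, LinearIsometryEquiv.enorm_map]

/-- `w` is the triple `(φ, ∇φ, φ|_∂Ω)`. -/
def IsTripleOf (w : TraceTriple Ω) (φ : E n → ℝ) : Prop :=
  w.fst.fst =ᵐ[volume.restrict Ω] φ ∧ w.fst.snd =ᵐ[volume.restrict Ω] gradient φ ∧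
    w.snd =ᵐ[surfaceMeasure Ω] φ

theorem IsTripleOf.smul_add {w z : TraceTriple Ω} {φ ψ : E n → ℝ} (hφ : ContDiff ℝ ∞ φ)
    (hψ : ContDiff ℝ ∞ ψ) (hw : IsTripleOf w φ) (hz : IsTripleOf z ψ) (c : ℝ) :
    IsTripleOf (c • w + z) (fun x => c * φ x + ψ x) := by
  refine ⟨?_, ?_, ?_⟩
  · change (c • w.fst.fst + z.fst.fst : Lp ℝ 2 (volume.restrict Ω)) =ᵐ[volume.restrict Ω] _
    filter_upwards [Lp.coeFn_add (c • w.fst.fst) z.fst.fst, Lp.coeFn_smul c w.fst.fst,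
      hw.1, hz.1] with x h1 h2 h3 h4
    rw [h1, Pi.add_apply, h2, Pi.smul_apply, h3, h4, smul_eq_mul]
  · change (c • w.fst.snd + z.fst.snd : Lp (E n) 2 (volume.restrict Ω)) =ᵐ[volume.restrict Ω] _
    filter_upwards [Lp.coeFn_add (c • w.fst.snd) z.fst.snd, Lp.coeFn_smul c w.fst.snd,
      hw.2.1, hz.2.1] with x h1 h2 h3 h4
    rw [h1, Pi.add_apply, h2, Pi.smul_apply, h3, h4, gradient_smul_add hφ hψ]
  · change (c • w.snd + z.snd : BdryL2 Ω) =ᵐ[surfaceMeasure Ω] _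
    filter_upwards [Lp.coeFn_add (c • w.snd) z.snd, Lp.coeFn_smul c w.snd,
      hw.2.2, hz.2.2] with x h1 h2 h3 h4
    rw [h1, Pi.add_apply, h2, Pi.smul_apply, h3, h4, smul_eq_mul]

theorem isTripleOf_zero : IsTripleOf (0 : TraceTriple Ω) 0 := by
  refine ⟨Lp.coeFn_zero _ _ _, ?_, Lp.coeFn_zero _ _ _⟩
  have h : gradient (0 : E n → ℝ) = 0 := by
    ext1 x
    exact gradient_const x 0
  rw [h]
  exact Lp.coeFn_zero _ _ _

/-- The triples `(φ, ∇φ, φ|_∂Ω)` of the smooth functions `φ`. -/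
def smoothTriples (Ω : Set (E n)) : Submodule ℝ (TraceTriple Ω) where
  carrier := {w | ∃ φ : E n → ℝ, ContDiff ℝ ∞ φ ∧ IsTripleOf w φ}
  zero_mem' := ⟨0, contDiff_const, isTripleOf_zero⟩
  add_mem' := by
    rintro w z ⟨φ, hφ, hw⟩ ⟨ψ, hψ, hz⟩
    refine ⟨fun x => 1 * φ x + ψ x, (contDiff_const.mul hφ).add hψ, ?_⟩
    simpa only [one_smul] using hw.smul_add hφ hψ hz 1
  smul_mem' := by
    rintro c w ⟨φ, hφ, hw⟩
    refine ⟨fun x => c * φ x + (0 : E n → ℝ) x, (contDiff_const.mul hφ).add contDiff_const, ?_⟩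
    have h := hw.smul_add hφ contDiff_const isTripleOf_zero c
    rwa [add_zero] at h

theorem enorm_sq_eq_lintegral {α F : Type*} [MeasurableSpace α] {μ : Measure α}
    [NormedAddCommGroup F] (f : Lp F 2 μ) : ‖f‖ₑ ^ 2 = ∫⁻ x, ‖f x‖ₑ ^ 2 ∂μ := by
  have h := eLpNorm_nnreal_pow_eq_lintegral (f := f) (μ := μ) (p := 2) two_ne_zero
  simp only [NNReal.coe_ofNat, ENNReal.rpow_ofNat, ENNReal.coe_ofNat] at h
  rw [Lp.enorm_def, h]

theorem norm_le_mul_of_enorm_sq_le {F G : Type*} [NormedAddCommGroup F] [NormedAddCommGroup G]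
    {x : F} {y : G} {C : ℝ≥0∞} (hC : C ≠ ⊤) (h : ‖x‖ₑ ^ 2 ≤ C * ‖y‖ₑ ^ 2) :
    ‖x‖ ≤ √C.toReal * ‖y‖ := by
  have h1 := ENNReal.toReal_mono (by finiteness) h
  simp only [ENNReal.toReal_mul, ENNReal.toReal_pow, toReal_enorm] at h1
  calc ‖x‖ = √(‖x‖ ^ 2) := (Real.sqrt_sq (norm_nonneg _)).symm
    _ ≤ √(C.toReal * ‖y‖ ^ 2) := Real.sqrt_le_sqrt h1
    _ = _ := by rw [Real.sqrt_mul ENNReal.toReal_nonneg, Real.sqrt_sq (norm_nonneg _)]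

theorem enorm_sq_fst_eq (w : L2Pair Ω) : ‖w‖ₑ ^ 2 = ‖w.fst‖ₑ ^ 2 + ‖w.snd‖ₑ ^ 2 := by
  simp only [← ofReal_norm]
  rw [← ENNReal.ofReal_pow (norm_nonneg _), ← ENNReal.ofReal_pow (norm_nonneg _),
    ← ENNReal.ofReal_pow (norm_nonneg _), ← ENNReal.ofReal_add (by positivity) (by positivity),
    WithLp.prod_norm_sq_eq_of_L2]

/-- The trace inequality is a closed condition, so it survives the closure. Hence the closure of the
smooth triples is a graph over the `L²` pairs, and traces are unique. -/
theorem exists_norm_bdry_le (hn : 1 ≤ n) (hΩ : IsLipschitzDomain Ω) :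
    ∃ C : ℝ, 0 ≤ C ∧ ∀ w ∈ closure (smoothTriples Ω : Set (TraceTriple Ω)),
      ‖w.snd‖ ≤ C * ‖w.fst‖ := by
  obtain ⟨C, hC, h⟩ := hΩ.traceBoundOn_frontier hn
  refine ⟨√C.toReal, Real.sqrt_nonneg _, fun w hw => ?_⟩
  refine closure_minimal (t := {w : TraceTriple Ω | ‖w.snd‖ ≤ √C.toReal * ‖w.fst‖}) ?_ ?_ hw
  · rintro w ⟨φ, hφ, h1, h2, h3⟩
    refine norm_le_mul_of_enorm_sq_le hC ?_
    have hφ1 : ContDiff ℝ 1 φ := hφ.of_le (by exact_mod_cast le_top)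
    rw [enorm_sq_fst_eq, enorm_sq_eq_lintegral, enorm_sq_eq_lintegral, enorm_sq_eq_lintegral]
    calc ∫⁻ x, ‖w.snd x‖ₑ ^ 2 ∂surfaceMeasure Ω = ∫⁻ x, ‖φ x‖ₑ ^ 2 ∂surfaceMeasure Ω :=
          lintegral_congr_ae (by filter_upwards [h3] with x hx; rw [hx])
      _ ≤ _ := h φ hφ1
      _ = C * ((∫⁻ x in Ω, ‖φ x‖ₑ ^ 2) + ∫⁻ x in Ω, ‖fderiv ℝ φ x‖ₑ ^ 2) := by
          rw [lintegral_add_left (hφ.continuous.enorm.measurable.pow_const 2)]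
      _ = _ := by
          congr 2
          · exact lintegral_congr_ae (by filter_upwards [h1] with x hx; rw [hx])
          · exact lintegral_congr_ae (by filter_upwards [h2] with x hx; rw [hx, enorm_gradient])
  · exact isClosed_le (WithLp.sndL 2 ℝ _ _).continuous.norm
      (continuous_const.mul (WithLp.fstL 2 ℝ _ _).continuous.norm)

/-- The integral over `∂Ω`. -/
def bdryIntegral (Ω : Set (E n)) [IsFiniteMeasure (surfaceMeasure Ω)] : BdryL2 Ω →L[ℝ] ℝ :=
  innerSL ℝ ((memLp_const (1 : ℝ)).toLp (fun _ => (1 : ℝ)) : BdryL2 Ω)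

theorem bdryIntegral_apply [IsFiniteMeasure (surfaceMeasure Ω)] (g : BdryL2 Ω) :
    bdryIntegral Ω g = ∫ x, g x ∂(surfaceMeasure Ω) := by
  rw [bdryIntegral, innerSL_apply_apply, L2.inner_def]
  refine integral_congr_ae ?_
  filter_upwards [MemLp.coeFn_toLp (memLp_const (1 : ℝ) (μ := surfaceMeasure Ω) (p := 2))] with x hx
  rw [hx]
  simp

variable [IsFiniteMeasure (surfaceMeasure Ω)] [IsFiniteMeasure (volume.restrict Ω)]

/-- The constant function `1`, its gradient and its trace. -/
def oneTriple (Ω : Set (E n)) [IsFiniteMeasure (surfaceMeasure Ω)]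
    [IsFiniteMeasure (volume.restrict Ω)] : TraceTriple Ω :=
  WithLp.toLp 2 (WithLp.toLp 2 ((memLp_const (1 : ℝ)).toLp, 0), (memLp_const (1 : ℝ)).toLp)

theorem isTripleOf_oneTriple : IsTripleOf (oneTriple Ω) fun _ => 1 := by
  refine ⟨MemLp.coeFn_toLp (memLp_const (1 : ℝ)), ?_, MemLp.coeFn_toLp (memLp_const (1 : ℝ))⟩
  have h : gradient (fun _ : E n => (1 : ℝ)) = 0 := by
    ext1 x
    exact gradient_const x 1
  rw [h]
  exact Lp.coeFn_zero _ _ _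

theorem exists_norm_sub_const_le (hn : 1 ≤ n) (hΩ : IsLipschitzDomain Ω) :
    ∃ C : ℝ, 0 ≤ C ∧ ∀ w ∈ smoothTriples Ω, ∃ c : ℝ,
      ‖w.fst.fst - c • (oneTriple Ω).fst.fst‖ ≤ C * ‖gradCLM Ω w‖ := by
  obtain ⟨C, hC, h⟩ := hΩ.poincareOn_self hn
  refine ⟨√C.toReal, Real.sqrt_nonneg _, ?_⟩
  rintro w ⟨φ, hφ, h1, h2, h3⟩
  obtain ⟨c, hc⟩ := h φ (hφ.of_le (by exact_mod_cast le_top))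
  refine ⟨c, norm_le_mul_of_enorm_sq_le hC ?_⟩
  rw [enorm_sq_eq_lintegral, enorm_sq_eq_lintegral]
  refine (le_of_eq (lintegral_congr_ae ?_)).trans (hc.trans (le_of_eq ?_))
  · filter_upwards [h1, Lp.coeFn_sub w.fst.fst (c • (oneTriple Ω).fst.fst),
      Lp.coeFn_smul c (oneTriple Ω).fst.fst, isTripleOf_oneTriple.1] with x e1 e2 e3 e4
    rw [e2, Pi.sub_apply, e3, Pi.smul_apply, e4, e1, smul_eq_mul, mul_one]
  · congr 1
    refine lintegral_congr_ae ?_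
    filter_upwards [h2] with x hx
    rw [← enorm_gradient, ← hx]
    rfl

theorem norm_le_norm_fst_add_norm_snd {F G : Type*} [NormedAddCommGroup F] [NormedAddCommGroup G]
    (w : WithLp 2 (F × G)) : ‖w‖ ≤ ‖w.fst‖ + ‖w.snd‖ := by
  rw [← pow_le_pow_iff_left₀ (norm_nonneg _) (by positivity) two_ne_zero,
    WithLp.prod_norm_sq_eq_of_L2]
  nlinarith [norm_nonneg w.fst, norm_nonneg w.snd]

/-- A bound modulo multiples of `e` is a bound up to a functional that does not vanish at `e`. -/
theorem norm_le_of_norm_sub_smul_le {X : Type*} [NormedAddCommGroup X] [NormedSpace ℝ X]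
    (ℓ : X →L[ℝ] ℝ) {e w : X} {K N c : ℝ} (he : 0 < ℓ e) (hK : 0 ≤ K) (hN : 0 ≤ N)
    (hc : ‖w - c • e‖ ≤ K * N) :
    ‖w‖ ≤ (K + ‖e‖ / ℓ e * (1 + ‖ℓ‖ * K)) * (N + |ℓ w|) := by
  have hcs : |c| ≤ (|ℓ w| + ‖ℓ‖ * (K * N)) / ℓ e := by
    have h2 : |c| * ℓ e = |c * ℓ e| := by rw [abs_mul, abs_of_pos he]
    have h3 : c * ℓ e = ℓ w - ℓ (w - c • e) := by
      rw [map_sub, map_smul, smul_eq_mul]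
      ring
    rw [le_div_iff₀ he, h2, h3]
    refine (abs_sub _ _).trans (add_le_add_right ?_ _)
    refine (ℓ.le_opNorm (w - c • e)).trans ?_
    gcongr
  have hm := abs_nonneg (ℓ w)
  have h4 := mul_nonneg (norm_nonneg ℓ) hK
  have h5 : |ℓ w| + ‖ℓ‖ * (K * N) ≤ (1 + ‖ℓ‖ * K) * (N + |ℓ w|) := by
    have := mul_nonneg h4 hm
    linarith
  have h6 : K * N ≤ K * (N + |ℓ w|) := by
    gcongr
    linarith
  calc ‖w‖ = ‖(w - c • e) + c • e‖ := by rw [sub_add_cancel]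
    _ ≤ K * N + |c| * ‖e‖ := by
      refine (norm_add_le _ _).trans (add_le_add hc ?_)
      rw [norm_smul, Real.norm_eq_abs]
    _ ≤ K * N + (|ℓ w| + ‖ℓ‖ * (K * N)) / ℓ e * ‖e‖ := by gcongr
    _ = K * N + ‖e‖ / ℓ e * (|ℓ w| + ‖ℓ‖ * (K * N)) := by ring
    _ ≤ K * (N + |ℓ w|) + ‖e‖ / ℓ e * ((1 + ‖ℓ‖ * K) * (N + |ℓ w|)) := by gcongr
    _ = _ := by ring

/-- The `H¹` norm and the norm of the trace are controlled by the gradient and the mean value on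
the boundary. -/
theorem exists_norm_le_norm_grad_add (hn : 1 ≤ n) (hΩ : IsLipschitzDomain Ω) :
    ∃ C : ℝ, 0 ≤ C ∧ ∀ w ∈ closure (smoothTriples Ω : Set (TraceTriple Ω)),
      ‖w‖ ≤ C * (‖gradCLM Ω w‖ + |bdryIntegral Ω (bdryCLM Ω w)|) := by
  obtain ⟨C₁, hC₁, h₁⟩ := exists_norm_sub_const_le hn hΩ
  obtain ⟨C₂, hC₂, h₂⟩ := exists_norm_bdry_le hn hΩ
  set e : TraceTriple Ω := oneTriple Ω with he
  -- The factor `C₁ + 1` bounds function and gradient together, and `C₂ + 1` adds the trace.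
  set K := (C₂ + 1) * (C₁ + 1) with hK
  have hK0 : 0 ≤ K := by positivity
  set s : ℝ := bdryIntegral Ω (bdryCLM Ω e) with hs
  have hs0 : 0 < s := by
    have h0 : s = (surfaceMeasure Ω).real univ := by
      have h1 : bdryCLM Ω e =ᵐ[surfaceMeasure Ω] fun _ => 1 := isTripleOf_oneTriple.2.2
      rw [hs, bdryIntegral_apply, integral_congr_ae h1]
      simp
    rw [h0, Measure.real, ENNReal.toReal_pos_iff]
    refine ⟨pos_iff_ne_zero.2 ?_, measure_lt_top _ _⟩
    rw [surfaceMeasure, Measure.restrict_apply_univ]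
    exact hΩ.measure_frontier_pos (hΩ.frontier_nonempty hn)
  have hgrade : gradCLM Ω e = 0 := rfl
  have hsub : ∀ w ∈ smoothTriples Ω, ∃ c : ℝ, ‖w - c • e‖ ≤ K * ‖gradCLM Ω w‖ := by
    intro w hw
    obtain ⟨c, hc⟩ := h₁ w hw
    have hwc : w - c • e ∈ smoothTriples Ω :=
      sub_mem hw (Submodule.smul_mem _ _ ⟨_, contDiff_const, isTripleOf_oneTriple⟩)
    have hgr : gradCLM Ω (w - c • e) = gradCLM Ω w := by
      rw [map_sub, map_smul, hgrade, smul_zero, sub_zero]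
    refine ⟨c, ?_⟩
    have e1 := h₂ _ (subset_closure hwc)
    have e2 := norm_le_norm_fst_add_norm_snd (w - c • e)
    have e3 := norm_le_norm_fst_add_norm_snd (w - c • e).fst
    have e4 : ‖(w - c • e).fst.snd‖ = ‖gradCLM Ω w‖ := congrArg norm hgr
    have e5 : ‖(w - c • e).fst.fst‖ ≤ C₁ * ‖gradCLM Ω w‖ := hc
    rw [hK]
    nlinarith [norm_nonneg (gradCLM Ω w), norm_nonneg (w - c • e).fst]
  set ℓ := (bdryIntegral Ω).comp (bdryCLM Ω) with hℓ
  refine ⟨K + ‖e‖ / s * (1 + ‖ℓ‖ * K), by positivity, fun w hw => ?_⟩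
  -- Once the unknown constant `c` has been traded for `ℓ w`, the inequality is visibly closed in
  -- `w`.
  refine closure_minimal (t := {w : TraceTriple Ω | ‖w‖ ≤ (K + ‖e‖ / s * (1 + ‖ℓ‖ * K)) *
    (‖gradCLM Ω w‖ + |ℓ w|)}) ?_ ?_ hw
  · intro w hw
    obtain ⟨c, hc⟩ := hsub w hw
    exact norm_le_of_norm_sub_smul_le ℓ hs0 hK0 (norm_nonneg _) hc
  · exact isClosed_le continuous_norm (continuous_const.mul
      ((gradCLM Ω).continuous.norm.add ℓ.continuous.abs))

end Spaces

/-! ### Characterisation of traces -/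

theorem memLp_two_of_continuous {α F : Type*} [TopologicalSpace α] [MeasurableSpace α]
    [OpensMeasurableSpace α] [SecondCountableTopology α] [NormedAddCommGroup F] {μ : Measure α}
    [IsFiniteMeasure μ] {K : Set α} (hK : IsCompact K) (hμ : ∀ᵐ x ∂μ, x ∈ K) {f : α → F}
    (hf : Continuous f) : MemLp f 2 μ := by
  obtain ⟨C, hC⟩ := hK.exists_bound_of_continuousOn hf.continuousOn
  refine MemLp.of_bound hf.aestronglyMeasurable C ?_
  filter_upwards [hμ] with x hx using hC x hx

variable {n : ℕ} {Ω : Set (E n)}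

/-- For each test function the defining identity equates two continuous functionals, namely `L²`
pairings with fixed functions. -/
theorem isClosed_H1 (Ω : Set (E n)) : IsClosed (H1 Ω : Set (L2Pair Ω)) := by
  have : (H1 Ω : Set (L2Pair Ω)) = ⋂ (φ : E n → ℝ) (_ : ContDiff ℝ ∞ φ) (_ : HasCompactSupport φ)
      (_ : tsupport φ ⊆ Ω) (e : E n), {p | ∫ x in Ω, p.fst x * fderiv ℝ φ x e
        = - ∫ x in Ω, inner ℝ (p.snd x) e * φ x} := by
    ext p
    simp only [mem_iInter]
    rfl
  rw [this]
  refine isClosed_iInter fun φ => isClosed_iInter fun hφ => isClosed_iInter fun hc =>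
    isClosed_iInter fun _ => isClosed_iInter fun e => ?_
  have m1 : MemLp (fun x => fderiv ℝ φ x e) 2 (volume.restrict Ω) :=
    ((hφ.continuous_fderiv (by simp)).clm_apply continuous_const).memLp_of_hasCompactSupport
      (hc.fderiv_apply ℝ e)
  have m2 : MemLp (fun x => φ x • e) 2 (volume.restrict Ω) :=
    (hφ.continuous.smul continuous_const).memLp_of_hasCompactSupport hc.smul_right
  have h1 : ∀ u : Lp ℝ 2 (volume.restrict Ω),
      ∫ x in Ω, u x * fderiv ℝ φ x e = inner ℝ (m1.toLp) u := by
    intro u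
    rw [L2.inner_def]
    refine integral_congr_ae ?_
    filter_upwards [m1.coeFn_toLp] with x hx
    rw [hx]
    rfl
  have h2 : ∀ v : Lp (E n) 2 (volume.restrict Ω),
      ∫ x in Ω, inner ℝ (v x) e * φ x = inner ℝ (m2.toLp) v := by
    intro v
    rw [L2.inner_def]
    refine integral_congr_ae ?_
    filter_upwards [m2.coeFn_toLp] with x hx
    rw [hx, real_inner_smul_left, real_inner_comm, mul_comm]
  simp only [h1, h2]
  exact isClosed_eq (continuous_const.inner (WithLp.fstL 2 ℝ _ _).continuous)
    (continuous_const.inner (WithLp.sndL 2 ℝ _ _).continuous).neg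

theorem IsLipschitzDomain.isFiniteMeasure_surfaceMeasure (hn : 1 ≤ n) (hΩ : IsLipschitzDomain Ω) :
    IsFiniteMeasure (surfaceMeasure Ω) :=
  ⟨by
    rw [surfaceMeasure, Measure.restrict_apply_univ]
    exact hΩ.measure_frontier_lt_top hn⟩

theorem IsLipschitzDomain.isFiniteMeasure_restrict (hΩ : IsLipschitzDomain Ω) :
    IsFiniteMeasure (volume.restrict Ω) :=
  ⟨by
    rw [Measure.restrict_apply_univ]
    exact hΩ.isBounded.measure_lt_top⟩

/-- This turns the sequential definition of the trace into membership in a closed subspace, so that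
linearity and completeness become available. -/
theorem isTrace_iff_mem_closure (hn : 1 ≤ n) (hΩ : IsLipschitzDomain Ω) (u : H1 Ω)
    (g : BdryL2 Ω) :
    IsTrace u g ↔ (WithLp.toLp 2 ((u : L2Pair Ω), g) : TraceTriple Ω) ∈
      closure (smoothTriples Ω : Set (TraceTriple Ω)) := by
  have := hΩ.isFiniteMeasure_surfaceMeasure hn
  have := hΩ.isFiniteMeasure_restrict
  have hcl : IsCompact (closure Ω) := Metric.isCompact_of_isClosed_isBounded isClosed_closure
    hΩ.isBounded.closure
  have hΩae : ∀ᵐ x ∂(volume.restrict Ω), x ∈ closure Ω := by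
    filter_upwards [ae_restrict_mem hΩ.isOpen.measurableSet] with x hx using subset_closure hx
  have hσae : ∀ᵐ x ∂(surfaceMeasure Ω), x ∈ closure Ω := by
    filter_upwards [ae_restrict_mem isClosed_frontier.measurableSet] with x hx
      using frontier_subset_closure hx
  have hgrad : ∀ φ : E n → ℝ, ContDiff ℝ ∞ φ → Continuous (gradient φ) := fun φ hφ =>
    (InnerProductSpace.toDual ℝ (E n)).symm.continuous.comp (hφ.continuous_fderiv (by simp))
  constructor
  · rintro ⟨φ, hφ, h1, h2, h3⟩
    have m1 := fun m => memLp_two_of_continuous hcl hΩae (hφ m).continuous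
    have m2 := fun m => memLp_two_of_continuous hcl hΩae (hgrad _ (hφ m))
    have m3 := fun m => memLp_two_of_continuous hcl hσae (hφ m).continuous
    have t1 := (Lp.tendsto_Lp_iff_tendsto_eLpNorm'' _ m1 _ (Lp.memLp (toFun u))).2 h1
    have t2 := (Lp.tendsto_Lp_iff_tendsto_eLpNorm'' _ m2 _ (Lp.memLp (weakGrad u))).2 h2
    have t3 := (Lp.tendsto_Lp_iff_tendsto_eLpNorm'' _ m3 _ (Lp.memLp g)).2 h3
    rw [Lp.toLp_coeFn] at t1 t2 t3
    have t12 := ((WithLp.prod_continuous_toLp 2 _ _).tendsto _).comp (t1.prodMk_nhds t2)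
    have t := ((WithLp.prod_continuous_toLp 2 _ _).tendsto _).comp (t12.prodMk_nhds t3)
    exact mem_closure_of_tendsto t (Eventually.of_forall fun m =>
      ⟨φ m, hφ m, (m1 m).coeFn_toLp, (m2 m).coeFn_toLp, (m3 m).coeFn_toLp⟩)
  · intro h
    obtain ⟨w, hw, ht⟩ := mem_closure_iff_seq_limit.1 h
    choose φ hφ hwφ using hw
    have tf := ((WithLp.fstL 2 ℝ (L2Pair Ω) (BdryL2 Ω)).continuous.tendsto _).comp ht
    have t1 := ((WithLp.fstL 2 ℝ (Lp ℝ 2 (volume.restrict Ω))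
      (Lp (E n) 2 (volume.restrict Ω))).continuous.tendsto _).comp tf
    have t2 := ((WithLp.sndL 2 ℝ (Lp ℝ 2 (volume.restrict Ω))
      (Lp (E n) 2 (volume.restrict Ω))).continuous.tendsto _).comp tf
    have t3 := ((WithLp.sndL 2 ℝ (L2Pair Ω) (BdryL2 Ω)).continuous.tendsto _).comp ht
    have t1' := (Lp.tendsto_Lp_iff_tendsto_eLpNorm' _ _).1 t1
    have t2' := (Lp.tendsto_Lp_iff_tendsto_eLpNorm' _ _).1 t2
    have t3' := (Lp.tendsto_Lp_iff_tendsto_eLpNorm' _ _).1 t3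
    refine ⟨φ, hφ, t1'.congr fun m => eLpNorm_congr_ae ?_, t2'.congr fun m => eLpNorm_congr_ae ?_,
      t3'.congr fun m => eLpNorm_congr_ae ?_⟩
    · filter_upwards [(hwφ m).1] with x hx
      rw [← hx]
      rfl
    · filter_upwards [(hwφ m).2.1] with x hx
      rw [← hx]
      rfl
    · filter_upwards [(hwφ m).2.2] with x hx
      rw [← hx]
      rfl

theorem IsTrace.unique (hn : 1 ≤ n) (hΩ : IsLipschitzDomain Ω) {u : H1 Ω} {g g' : BdryL2 Ω}
    (h : IsTrace u g) (h' : IsTrace u g') : g = g' := by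
  rw [isTrace_iff_mem_closure hn hΩ, ← Submodule.topologicalClosure_coe] at h h'
  obtain ⟨C, -, hC⟩ := exists_norm_bdry_le hn hΩ
  have hs := sub_mem h h'
  rw [← SetLike.mem_coe, Submodule.topologicalClosure_coe] at hs
  have h1 := hC _ hs
  have h2 : ‖g - g'‖ ≤ C * ‖(u : L2Pair Ω) - u‖ := h1
  rw [sub_self, norm_zero, mul_zero, norm_le_zero_iff, sub_eq_zero] at h2
  exact h2

theorem IsTrace.trace_eq (hn : 1 ≤ n) (hΩ : IsLipschitzDomain Ω) {u : H1 Ω} {g : BdryL2 Ω}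
    (h : IsTrace u g) : trace u = g := by
  have hex : ∃ g, IsTrace u g := ⟨g, h⟩
  rw [trace, dif_pos hex]
  exact hex.choose_spec.unique hn hΩ h

/-! ### Restriction of vector fields -/

/-- Restriction of vector fields from `Ω` to `D`. -/
def restrictCLM (Ω D : Set (E n)) : Lp (E n) 2 (volume.restrict Ω) →L[ℝ]
    Lp (E n) 2 ((volume.restrict Ω).restrict D) :=
  LpToLpRestrictCLM (E n) (E n) ℝ (volume.restrict Ω) 2 D

theorem norm_restrictCLM_le (D : Set (E n)) (G : Lp (E n) 2 (volume.restrict Ω)) :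
    ‖restrictCLM Ω D G‖ ≤ ‖G‖ :=
  norm_Lp_toLp_restrict_le D G

theorem integral_conductivity_mul_inner {D : Set (E n)} (hD : MeasurableSet D) (k₀ k : ℝ)
    (G G' : Lp (E n) 2 (volume.restrict Ω)) :
    ∫ x in Ω, conductivity D k₀ k x * inner ℝ (G x) (G' x)
      = k₀ * inner ℝ G G' + (k - k₀) * inner ℝ (restrictCLM Ω D G) (restrictCLM Ω D G') := by
  have hi := L2.integrable_inner (𝕜 := ℝ) G G'
  have h1 : ∫ x in D, inner ℝ (G x) (G' x) ∂(volume.restrict Ω)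
      = inner ℝ (restrictCLM Ω D G) (restrictCLM Ω D G') := by
    rw [L2.inner_def]
    refine integral_congr_ae ?_
    filter_upwards [LpToLpRestrictCLM_coeFn ℝ D G, LpToLpRestrictCLM_coeFn ℝ D G'] with x hx hx'
    rw [restrictCLM, hx, hx']
  have h2 : ∀ x, conductivity D k₀ k x * inner ℝ (G x) (G' x) = k₀ * inner ℝ (G x) (G' x)
      + (k - k₀) * D.indicator (fun x => inner ℝ (G x) (G' x)) x := by
    intro x
    by_cases hx : x ∈ D
    · simp [conductivity, hx]
      ring
    · simp [conductivity, hx]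
  simp only [h2]
  rw [integral_add (hi.const_mul _) ((hi.indicator hD).const_mul _), integral_const_mul,
    integral_const_mul, integral_indicator hD, h1, L2.inner_def G]

theorem inner_bdryL2_eq (f g : BdryL2 Ω) :
    inner ℝ f g = ∫ x, f x * g x ∂(surfaceMeasure Ω) := by
  rw [L2.inner_def]
  exact integral_congr_ae (ae_of_all _ fun x => mul_comm _ _)

/-! ### The energy space -/

/-- The space `V`, each function being given together with its trace. -/
def energySpace (Ω : Set (E n)) [IsFiniteMeasure (surfaceMeasure Ω)] :
    Submodule ℝ (TraceTriple Ω) :=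
  (smoothTriples Ω).topologicalClosure ⊓
    ((H1 Ω).comap (WithLp.fstL 2 ℝ (L2Pair Ω) (BdryL2 Ω)).toLinearMap ⊓
      ((bdryIntegral Ω).comp (bdryCLM Ω)).ker)

section EnergySpace

variable [IsFiniteMeasure (surfaceMeasure Ω)]

theorem mem_energySpace {w : TraceTriple Ω} : w ∈ energySpace Ω ↔
    w ∈ closure (smoothTriples Ω : Set (TraceTriple Ω)) ∧ w.fst ∈ H1 Ω ∧
      ∫ x, w.snd x ∂(surfaceMeasure Ω) = 0 := by
  rw [← bdryIntegral_apply, ← Submodule.topologicalClosure_coe]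
  rfl

theorem isClosed_energySpace : IsClosed (energySpace Ω : Set (TraceTriple Ω)) := by
  refine (Submodule.isClosed_topologicalClosure _).inter (IsClosed.inter ?_ ?_)
  · exact (isClosed_H1 Ω).preimage (WithLp.fstL 2 ℝ (L2Pair Ω) (BdryL2 Ω)).continuous
  · exact ContinuousLinearMap.isClosed_ker _

/-- The Hilbert space `energySpace Ω` as a type of its own. -/
def EnergySpace (Ω : Set (E n)) [IsFiniteMeasure (surfaceMeasure Ω)] : Type := energySpace Ω

instance : NormedAddCommGroup (EnergySpace Ω) :=
  inferInstanceAs (NormedAddCommGroup (energySpace Ω))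

instance : InnerProductSpace ℝ (EnergySpace Ω) :=
  inferInstanceAs (InnerProductSpace ℝ (energySpace Ω))

instance : CompleteSpace (EnergySpace Ω) :=
  (isClosed_energySpace (Ω := Ω)).completeSpace_coe

/-- The inclusion into the triples. -/
def energyIncl (Ω : Set (E n)) [IsFiniteMeasure (surfaceMeasure Ω)] :
    EnergySpace Ω →L[ℝ] TraceTriple Ω :=
  (energySpace Ω).subtypeL

theorem energyIncl_mem (w : EnergySpace Ω) : energyIncl Ω w ∈ energySpace Ω := Subtype.property _

theorem norm_energyIncl (w : EnergySpace Ω) : ‖energyIncl Ω w‖ = ‖w‖ := rfl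

/-- The function underlying an element of the energy space. -/
def energyToH1 (Ω : Set (E n)) [IsFiniteMeasure (surfaceMeasure Ω)] : EnergySpace Ω →L[ℝ] H1 Ω :=
  ((WithLp.fstL 2 ℝ (L2Pair Ω) (BdryL2 Ω)).comp (energyIncl Ω)).codRestrict (H1 Ω)
    fun w => (mem_energySpace.1 (energyIncl_mem w)).2.1

/-- The gradient on the energy space. -/
def energyGrad (Ω : Set (E n)) [IsFiniteMeasure (surfaceMeasure Ω)] :
    EnergySpace Ω →L[ℝ] Lp (E n) 2 (volume.restrict Ω) :=
  (gradCLM Ω).comp (energyIncl Ω)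

/-- The trace on the energy space. -/
def energyTrace (Ω : Set (E n)) [IsFiniteMeasure (surfaceMeasure Ω)] :
    EnergySpace Ω →L[ℝ] BdryL2 Ω :=
  (bdryCLM Ω).comp (energyIncl Ω)

theorem isTrace_energyToH1 (hn : 1 ≤ n) (hΩ : IsLipschitzDomain Ω) (w : EnergySpace Ω) :
    IsTrace (energyToH1 Ω w) (energyTrace Ω w) :=
  (isTrace_iff_mem_closure hn hΩ _ _).2 (mem_energySpace.1 (energyIncl_mem w)).1

theorem trace_energyToH1 (hn : 1 ≤ n) (hΩ : IsLipschitzDomain Ω) (w : EnergySpace Ω) :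
    trace (energyToH1 Ω w) = energyTrace Ω w :=
  (isTrace_energyToH1 hn hΩ w).trace_eq hn hΩ

theorem weakGrad_energyToH1 (w : EnergySpace Ω) : weakGrad (energyToH1 Ω w) = energyGrad Ω w := rfl

theorem energyToH1_mem_V (hn : 1 ≤ n) (hΩ : IsLipschitzDomain Ω) (w : EnergySpace Ω) :
    energyToH1 Ω w ∈ V Ω :=
  ⟨⟨_, isTrace_energyToH1 hn hΩ w⟩, by
    rw [trace_energyToH1 hn hΩ]
    exact (mem_energySpace.1 (energyIncl_mem w)).2.2⟩

/-- Together with `energyToH1_mem_V` this identifies `V` with a Hilbert space. Density of smooth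
functions in `H¹` is not needed, since membership in `V` includes the existence of a trace. -/
theorem exists_energyToH1_eq (hn : 1 ≤ n) (hΩ : IsLipschitzDomain Ω) {u : H1 Ω} (hu : u ∈ V Ω) :
    ∃ w : EnergySpace Ω, energyToH1 Ω w = u := by
  obtain ⟨⟨g, hg⟩, h0⟩ := hu
  have hg' : IsTrace u (trace u) := by rwa [hg.trace_eq hn hΩ]
  exact ⟨⟨WithLp.toLp 2 ((u : L2Pair Ω), trace u),
    mem_energySpace.2 ⟨(isTrace_iff_mem_closure hn hΩ _ _).1 hg', u.2, h0⟩⟩, rfl⟩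

theorem exists_norm_le_norm_energyGrad (hn : 1 ≤ n) (hΩ : IsLipschitzDomain Ω) :
    ∃ C : ℝ, 0 ≤ C ∧ ∀ w : EnergySpace Ω, ‖w‖ ≤ C * ‖energyGrad Ω w‖ := by
  have := hΩ.isFiniteMeasure_restrict
  obtain ⟨C, hC, h⟩ := exists_norm_le_norm_grad_add hn hΩ
  refine ⟨C, hC, fun w => ?_⟩
  have h1 := h _ (mem_energySpace.1 (energyIncl_mem w)).1
  have h0 : bdryIntegral Ω (bdryCLM Ω (energyIncl Ω w)) = 0 := by
    rw [bdryIntegral_apply]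
    exact (mem_energySpace.1 (energyIncl_mem w)).2.2
  rwa [h0, abs_zero, add_zero, norm_energyIncl] at h1

/-- The infimum defining the operator norm is itself admissible. A vanishing gradient is treated
apart, through the coercivity constant, because the argument divides by its norm. -/
theorem norm_energyTrace_le (hn : 1 ≤ n) (hΩ : IsLipschitzDomain Ω) (w : EnergySpace Ω) :
    ‖energyTrace Ω w‖ ≤ traceNorm Ω * ‖energyGrad Ω w‖ := by
  obtain ⟨C, hC, h⟩ := exists_norm_le_norm_energyGrad hn hΩ
  have hCw : ∀ w : EnergySpace Ω, ‖energyTrace Ω w‖ ≤ C * ‖energyGrad Ω w‖ := fun w =>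
    (WithLp.norm_snd_le _ (energyIncl Ω w)).trans (h w)
  -- The set of admissible constants is nonempty, so `traceNorm` is a genuine infimum and not the
  -- default value `0` of `sInf`.
  have hmem : C ∈ {c : ℝ | 0 ≤ c ∧ ∀ v ∈ V Ω, ‖trace v‖ ≤ c * normV v} := by
    refine ⟨hC, fun v hv => ?_⟩
    obtain ⟨w, rfl⟩ := exists_energyToH1_eq hn hΩ hv
    rw [trace_energyToH1 hn hΩ, normV, weakGrad_energyToH1]
    exact hCw w
  rcases (norm_nonneg (energyGrad Ω w)).eq_or_lt with h0 | h0
  · have := hCw w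
    rwa [← h0, mul_zero] at this ⊢
  · rw [← div_le_iff₀ h0]
    refine le_csInf ⟨C, hmem⟩ fun c hc => ?_
    rw [div_le_iff₀ h0]
    have := hc.2 _ (energyToH1_mem_V hn hΩ w)
    rwa [trace_energyToH1 hn hΩ] at this

theorem traceNorm_nonneg (Ω : Set (E n)) : 0 ≤ traceNorm Ω := Real.sInf_nonneg fun _ hc => hc.1

/-! ### The variational problem on the energy space -/

/-- The Riesz representative of the functional `v ↦ ∫ f 𝔱 v dσ`. -/
def load (f : BdryL2 Ω) : EnergySpace Ω := 
  ContinuousLinearMap.adjoint (energyTrace Ω) f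

theorem inner_load (f : BdryL2 Ω) (w : EnergySpace Ω) :
    inner ℝ (load f) w = inner ℝ f (energyTrace Ω w) :=
  ContinuousLinearMap.adjoint_inner_left (energyTrace Ω) w f

theorem inner_load_le (hn : 1 ≤ n) (hΩ : IsLipschitzDomain Ω) (f : BdryL2 Ω) (w : EnergySpace Ω) :
    inner ℝ (load f) w ≤ traceNorm Ω * ‖f‖ * ‖energyGrad Ω w‖ := by
  rw [inner_load]
  calc inner ℝ f (energyTrace Ω w) ≤ ‖f‖ * ‖energyTrace Ω w‖ := real_inner_le_norm _ _
    _ ≤ ‖f‖ * (traceNorm Ω * ‖energyGrad Ω w‖) := by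
      gcongr
      exact norm_energyTrace_le hn hΩ w
    _ = _ := by ring

/-- The operator of the form `∫_Ω ∇u · ∇v`. -/
def gradGram (Ω : Set (E n)) [IsFiniteMeasure (surfaceMeasure Ω)] :
    EnergySpace Ω →L[ℝ] EnergySpace Ω :=
  gramOp (energyGrad Ω)

/-- The operator of the form `∫_D ∇u · ∇v`. -/
def gradGramOn (Ω D : Set (E n)) [IsFiniteMeasure (surfaceMeasure Ω)] :
    EnergySpace Ω →L[ℝ] EnergySpace Ω :=
  gramOp ((restrictCLM Ω D).comp (energyGrad Ω))

theorem inner_gradGram (w v : EnergySpace Ω) :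
    inner ℝ (gradGram Ω w) v = inner ℝ (energyGrad Ω w) (energyGrad Ω v) :=
  inner_gramOp (energyGrad Ω) w v

theorem inner_gradGramOn (D : Set (E n)) (w v : EnergySpace Ω) :
    inner ℝ (gradGramOn Ω D w) v
      = inner ℝ (restrictCLM Ω D (energyGrad Ω w)) (restrictCLM Ω D (energyGrad Ω v)) :=
  inner_gramOp ((restrictCLM Ω D).comp (energyGrad Ω)) w v

theorem exists_isEnergyPair (hn : 1 ≤ n) (hΩ : IsLipschitzDomain Ω) (D : Set (E n)) :
    ∃ C : ℝ, IsEnergyPair (gradGram Ω) (gradGramOn Ω D) (fun w => ‖energyGrad Ω w‖) C := by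
  obtain ⟨C, -, hC⟩ := exists_norm_le_norm_energyGrad hn hΩ
  refine ⟨C, fun w => norm_nonneg _, hC, fun w => ?_, fun w => ?_, fun w v => ?_⟩
  · rw [inner_gradGram, real_inner_self_eq_norm_sq]
  · rw [inner_gradGramOn]
    exact real_inner_self_nonneg
  · rw [inner_gradGramOn]
    exact (abs_real_inner_le_norm _ _).trans (mul_le_mul (norm_restrictCLM_le D _)
      (norm_restrictCLM_le D _) (norm_nonneg _) (norm_nonneg _))

theorem integral_conductivity_eq_inner_stiffness {D : Set (E n)} (hD : MeasurableSet D)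
    (k₀ k : ℝ) (w v : EnergySpace Ω) :
    ∫ x in Ω, conductivity D k₀ k x *
        inner ℝ (weakGrad (energyToH1 Ω w) x) (weakGrad (energyToH1 Ω v) x)
      = inner ℝ (stiffness (gradGram Ω) (gradGramOn Ω D) k₀ k w) v := by
  rw [inner_stiffness, inner_gradGram, inner_gradGramOn]
  exact integral_conductivity_mul_inner hD k₀ k (energyGrad Ω w) (energyGrad Ω v)

theorem integral_mul_trace_eq_inner_load (hn : 1 ≤ n) (hΩ : IsLipschitzDomain Ω) (f : BdryL2 Ω)
    (v : EnergySpace Ω) :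
    ∫ x, f x * trace (energyToH1 Ω v) x ∂(surfaceMeasure Ω) = inner ℝ (load f) v := by
  rw [inner_load, trace_energyToH1 hn hΩ, inner_bdryL2_eq]

theorem isVariationalSolution_energyToH1_iff (hn : 1 ≤ n) (hΩ : IsLipschitzDomain Ω)
    {D : Set (E n)} (hD : MeasurableSet D) (k₀ k : ℝ) (f : BdryL2 Ω) (w : EnergySpace Ω) :
    IsVariationalSolution D k₀ f k (energyToH1 Ω w) ↔
      stiffness (gradGram Ω) (gradGramOn Ω D) k₀ k w = load f := by
  constructor
  · intro hw
    refine ext_inner_right ℝ fun v => ?_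
    rw [← integral_conductivity_eq_inner_stiffness hD, ← integral_mul_trace_eq_inner_load hn hΩ]
    exact hw.2 _ (energyToH1_mem_V hn hΩ v)
  · intro hw
    refine ⟨energyToH1_mem_V hn hΩ w, fun v hv => ?_⟩
    obtain ⟨z, rfl⟩ := exists_energyToH1_eq hn hΩ hv
    rw [integral_conductivity_eq_inner_stiffness hD, integral_mul_trace_eq_inner_load hn hΩ, hw]

theorem isVariationalSolution_iff (hn : 1 ≤ n) (hΩ : IsLipschitzDomain Ω) {D : Set (E n)}
    (hD : MeasurableSet D) {k₀ k : ℝ} (hk₀ : 0 < k₀) (hk : 0 < k) (f : BdryL2 Ω) (u : H1 Ω) :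
    IsVariationalSolution D k₀ f k u ↔
      u = energyToH1 Ω (resolvent (gradGram Ω) (gradGramOn Ω D) k₀ (load f) k) := by
  obtain ⟨C, hC⟩ := exists_isEnergyPair hn hΩ D
  constructor
  · intro hu
    obtain ⟨w, rfl⟩ := exists_energyToH1_eq hn hΩ hu.1
    rw [isVariationalSolution_energyToH1_iff hn hΩ hD,
      hC.stiffness_apply_eq_iff hk₀ (load f) hk] at hu
    rw [hu]
  · rintro rfl
    rw [isVariationalSolution_energyToH1_iff hn hΩ hD,
      hC.stiffness_apply_eq_iff hk₀ (load f) hk]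

theorem solution_eq (hn : 1 ≤ n) (hΩ : IsLipschitzDomain Ω) {D : Set (E n)}
    (hD : MeasurableSet D) {k₀ k : ℝ} (hk₀ : 0 < k₀) (hk : 0 < k) (f : BdryL2 Ω) :
    solution D k₀ f k
      = energyToH1 Ω (resolvent (gradGram Ω) (gradGramOn Ω D) k₀ (load f) k) := by
  have hex : ∃ u, IsVariationalSolution D k₀ f k u :=
    ⟨_, (isVariationalSolution_iff hn hΩ hD hk₀ hk f _).2 rfl⟩
  rw [solution, dif_pos hex]
  exact (isVariationalSolution_iff hn hΩ hD hk₀ hk f _).1 hex.choose_spec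

/-- Solution and resolvent are identified only for `k > 0`. This set is open, so the derivatives
agree there too, and a bounded linear map commutes with them. -/
theorem iteratedDeriv_solution (hn : 1 ≤ n) (hΩ : IsLipschitzDomain Ω) {D : Set (E n)}
    (hD : MeasurableSet D) {k₀ : ℝ} (hk₀ : 0 < k₀) (f : BdryL2 Ω) (j : ℕ) {k : ℝ} (hk : 0 < k) :
    iteratedDeriv j (fun κ => solution D k₀ f κ) k = energyToH1 Ω
      (iteratedDeriv j (resolvent (gradGram Ω) (gradGramOn Ω D) k₀ (load f)) k) := by
  obtain ⟨C, hC⟩ := exists_isEnergyPair hn hΩ D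
  induction j generalizing k with
  | zero => simpa only [iteratedDeriv_zero] using solution_eq hn hΩ hD hk₀ hk f
  | succ j ih =>
    have h := (energyToH1 Ω).hasFDerivAt.comp_hasDerivAt k
      (hC.hasDerivAt_iteratedDeriv_resolvent hk₀ (load f) j hk)
    rw [iteratedDeriv_succ]
    refine (h.congr_of_eventuallyEq ?_).deriv
    filter_upwards [lt_mem_nhds hk] with κ hκ using ih hκ

end EnergySpace

end Inclusion

end

/-! ### Conclusion for the boundary value problem -/

theorem lemma4p1 (n : ℕ) (hn : 2 ≤ n) (Ω D : Set (Inclusion.E n))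
    (hΩ : Inclusion.IsLipschitzDomain Ω) (hD : Inclusion.IsLipschitzDomain D)
    (hDΩ : closure D ⊆ Ω) (k₀ : ℝ) (hk₀ : 0 < k₀) (f : Inclusion.BdryL2 Ω) :
    (∀ k ∈ Set.Ioi (0 : ℝ) \ {k₀},
      (∃! u : Inclusion.H1 Ω, Inclusion.IsVariationalSolution D k₀ f k u) ∧
      (∃! g : Inclusion.BdryL2 Ω, Inclusion.IsTrace (Inclusion.solution D k₀ f k) g)) ∧
    AnalyticOnNhd ℝ (fun k : ℝ => Inclusion.trace (Inclusion.solution (Ω := Ω) D k₀ f k))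
      (Set.Ioi (0 : ℝ) \ {k₀}) ∧
    AnalyticOnNhd ℝ (fun k : ℝ => Inclusion.solution (Ω := Ω) D k₀ f k)
      (Set.Ioi (0 : ℝ) \ {k₀}) ∧
    ∀ (j : ℕ), ∀ k ∈ Set.Ioi (0 : ℝ) \ {k₀},
      iteratedDeriv j (fun κ : ℝ => Inclusion.solution (Ω := Ω) D k₀ f κ) k ∈ Inclusion.V Ω ∧
      Inclusion.normV (iteratedDeriv j (fun κ : ℝ => Inclusion.solution (Ω := Ω) D k₀ f κ) k)
        ≤ Inclusion.traceNorm Ω * ‖f‖ * (j.factorial : ℝ) / (min k k₀) ^ (j + 1) := by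
  open Inclusion in
  have hn1 : 1 ≤ n := by omega
  have := hΩ.isFiniteMeasure_surfaceMeasure hn1
  have hDm : MeasurableSet D := hD.isOpen.measurableSet
  obtain ⟨C, hC⟩ := exists_isEnergyPair hn1 hΩ D
  have hsol := fun (k : ℝ) (hk : 0 < k) => solution_eq hn1 hΩ hDm hk₀ hk f
  have han := fun (k : ℝ) (hk : 0 < k) => hC.analyticAt_resolvent hk₀ (load f) hk
  refine ⟨fun k hk => ⟨?_, ?_⟩, fun k hk => ?_, fun k hk => ?_, fun j k hk => ?_⟩
  · exact ⟨_, (isVariationalSolution_iff hn1 hΩ hDm hk₀ hk.1 f _).2 rfl,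
      fun u hu => (isVariationalSolution_iff hn1 hΩ hDm hk₀ hk.1 f u).1 hu⟩
  · rw [hsol k hk.1]
    exact ⟨_, isTrace_energyToH1 hn1 hΩ _,
      fun g hg => hg.unique hn1 hΩ (isTrace_energyToH1 hn1 hΩ _)⟩
  · refine (((energyTrace Ω).analyticAt _).comp (han k hk.1)).congr ?_
    filter_upwards [lt_mem_nhds hk.1] with κ hκ
    rw [hsol κ hκ, trace_energyToH1 hn1 hΩ]
    rfl
  · refine (((energyToH1 Ω).analyticAt _).comp (han k hk.1)).congr ?_
    filter_upwards [lt_mem_nhds hk.1] with κ hκ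
    rw [hsol κ hκ]
    rfl
  · rw [iteratedDeriv_solution hn1 hΩ hDm hk₀ f j hk.1]
    refine ⟨energyToH1_mem_V hn1 hΩ _, ?_⟩
    exact hC.norm_iteratedDeriv_resolvent_le hk₀
      (mul_nonneg (traceNorm_nonneg Ω) (norm_nonneg f)) (inner_load_le hn1 hΩ f) j hk.1
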